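/- Let $n\ge 1$, $\alpha=\pi/(2n+1)$, and let $\Delta_0\subseteq\mathbb{E}^2$ be an isosceles triangle with angles $\alpha$ (at the apex), $n\alpha$, $n\alpha$. Let $V$ be the space of affine linear functions $v(x)=\langle a,x\rangle+c$ on $\mathbb{E}^2$ with the bilinear form $(v,v')=\langle a,a'\rangle$, and put $\Pi_v=\{x\mid v(x)<0\}$. The *initial seed* $x_0=(\mathbf v_0,B_0)$ consists of the three functions $v_0,v_1,v_2\in V$ with $(v_i,v_i)=2$ that vanish on the base (index $0$) and on the two legs (indices $1,2$) of $\Delta_0$ and are negative inside $\Delta_0$, and of the skew-symmetric matrix $B_0$ with $b_{01}=b_{02}=2\cos(n\alpha)$ and $b_{12}=2\cos\alpha$ (so the base is the source and leg $2$ is the sink of the quiver). Let $b$ be the line through the feet $H_0,H_2$ of the altitudes of $\Delta_0$ on the sides $0$ and $2$. The reference point is the point infinitely far away on $b$ in the direction from $H_0$ to $H_2$, that is, $v\in V$ is called *positive* if $\Pi_v$ contains $H_0+t(H_2-H_0)$ for all sufficiently large $t$. The *mutation* of $(\mathbf v,B)$ at $k$ is $(\mathbf v',B')$, where $b'_{ij}=-b_{ij}$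 if $k\in\{i,j\}$ and $b'_{ij}=b_{ij}+(b_{ik}|b_{kj}|+|b_{ik}|b_{kj})/2$ otherwise, $v_k'=-v_k$, and for $i\ne k$: if $v_k$ is positive, then $v_i'=v_i$ when $b_{ik}>0$ and $v_i'=v_i-(v_i,v_k)v_k$ otherwise; if $v_k$ is not positive, then $v_i'=v_i$ when $b_{ik}<0$ and $v_i'=v_i-(v_i,v_k)v_k$ otherwise. Seeds that differ by a simultaneous permutation of the indices are identified. The *exchange graph* $\Gamma$ has as vertices all seeds obtained from $x_0$ by sequences of mutations, two of them being adjacent if they are related by a single mutation; it carries the graph distance. For $w\in\mathbb{E}^2$ the translated seed $w+(\mathbf v,B)$ is obtained by replacing each $v_i$ by $x\mapsto v_i(x-w)$. The *translation lattice* $L\subseteq\mathbb{R}$ is the subgroup generated by the lengths $\lVert w\rVert$ of all $w\in\mathbb{E}^2$ for which $\Gamma$ contains two seeds $x,y$ with $x=w+y$; an element $\ell\in L$ is identified with the vector $\ell e$, where $e$ is the unit vector parallel to $b$ pointing from $H_0$ to $H_2$. Then: 1. The map $(w,x)\mapsto w+x$ is a well-defined action of $L$ on $\Gamma$ by graph automorphisms.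 It is isometric, properly discontinuous (for every vertex $x$ and every $\rho\in\mathbb{R}$ only finitely many $w\in L$ satisfy $d(x,w+x)\le \rho$), and has finitely many orbits of vertices. 2. $L$ is finitely generated of rank $r=\operatorname{rk}_{\mathbb{Z}}(L)=\varphi(2n+1)/2$. 3. For every finite symmetric generating set $S\subseteq L\setminus\{0\}$ the map $L\to\Gamma$, $w\mapsto w+x_0$, is a quasi-isometry from the Cayley graph $\operatorname{Cay}_S(L)$ to $\Gamma$. 4. $\Gamma$ is quasi-isometric to $\mathbb{Z}^r$, viewed as the graph in which two lattice points are adjacent if and only if their Euclidean distance is $1$. Here $f\colon M_1\to M_2$ is a *quasi-isometry* if there are $a\ge1$, $b,c\ge0$ with $\frac1a d_1(x,y)-b\le d_2(f(x),f(y))\le a\,d_1(x,y)+b$ for all $x,y\in M_1$, and every point of $M_2$ is at distance at most $c$ from a point of $f(M_1)$. -/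

import Mathlib

namespace AffineExchange

noncomputable section

open Filter

/-- The Euclidean plane. -/
abbrev Plane : Type := EuclideanSpace ℝ (Fin 2)

/-- The three-dimensional quadratic space of affine linear functions on the plane: the pair
`(a, c)` stands for the function `x ↦ ⟪a, x⟫ + c`. -/
abbrev QuadSpace : Type := Plane × ℝ

/-- The affine linear function on the plane given by a vector of the quadratic space. -/
def evalAt (v : QuadSpace) (x : Plane) : ℝ := inner ℝ v.1 x + v.2

/-- The degenerate symmetric bilinear form `(·,·)`; its radical consists of the constants. -/
def form (v w : QuadSpace) : ℝ := inner ℝ v.1 w.1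

/-- The open half-plane `Π_v`. -/
def halfPlane (v : QuadSpace) : Set Plane := {x | evalAt v x < 0}

/-- Mutation of exchange matrices. -/
def mutateMatrix (B : Matrix (Fin 3) (Fin 3) ℝ) (k : Fin 3) : Matrix (Fin 3) (Fin 3) ℝ :=
  fun i j =>
    if i = k ∨ j = k then -B i j
    else B i j + (B i k * |B k j| + |B i k| * B k j) / 2

/-- A pair `(v, B)` of a triple of vectors and an exchange matrix, with numbered entries. -/
structure LabelledSeed where
  /-- the triple of vectors -/
  v : Fin 3 → QuadSpace
  /-- the exchange matrix; there is an arrow `i → j` when `0 < B i j` -/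
  B : Matrix (Fin 3) (Fin 3) ℝ

/-- Two labelled seeds are identified when they differ by a permutation of the entries. -/
instance seedSetoid : Setoid LabelledSeed where
  r s t := ∃ σ : Equiv.Perm (Fin 3), (∀ i, t.v i = s.v (σ i)) ∧ ∀ i j, t.B i j = s.B (σ i) (σ j)
  iseqv :=
    { refl := fun _ => ⟨1, fun _ => rfl, fun _ _ => rfl⟩
      symm := by
        rintro s t ⟨σ, h₁, h₂⟩
        exact ⟨σ⁻¹, fun i => by simp [h₁], fun i j => by simp [h₂]⟩
      trans := by
        rintro s t u ⟨σ, h₁, h₂⟩ ⟨ρ, h₃, h₄⟩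
        exact ⟨σ * ρ, fun i => by simp [h₁, h₃], fun i j => by simp [h₂, h₄]⟩ }

/-- Seeds up to permutation of the entries. -/
abbrev Seed : Type := Quotient seedSetoid

/-- The function `x ↦ v (x - w)`, whose half-plane is the translate of `Π_v` by `w`. -/
def translateVector (w : Plane) (v : QuadSpace) : QuadSpace := (v.1, v.2 - inner ℝ v.1 w)

/-- The translated seed `w + (v, B)`, for labelled seeds. -/
def LabelledSeed.translate (w : Plane) (s : LabelledSeed) : LabelledSeed where
  v i := translateVector w (s.v i)
  B := s.B

/-- The translated seed `w + (v, B)`. -/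
def translate (w : Plane) : Seed → Seed :=
  Quotient.map (LabelledSeed.translate w) (by
    rintro s t ⟨σ, h₁, h₂⟩
    exact ⟨σ, fun i => by simp [LabelledSeed.translate, h₁],
      fun i j => by simp [LabelledSeed.translate, h₂]⟩)

/-- The initial triangle: isosceles with angles `α`, `n α`, `n α`, where `α = π / (2 n + 1)`.
The vertex with index `0` is the apex. -/
def IsInitialTriangle (n : ℕ) (T : Affine.Triangle ℝ Plane) : Prop :=
  EuclideanGeometry.angle (T.points 1) (T.points 0) (T.points 2) = Real.pi / (2 * n + 1) ∧
  EuclideanGeometry.angle (T.points 0) (T.points 1) (T.points 2) = n * (Real.pi / (2 * n + 1)) ∧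
  EuclideanGeometry.angle (T.points 0) (T.points 2) (T.points 1) = n * (Real.pi / (2 * n + 1))

/-- The vector of length `√2` perpendicular to the side opposite to the vertex `i`, pointing out
of the triangle. -/
def outerNormal (T : Affine.Triangle ℝ Plane) (i : Fin 3) : Plane :=
  (√2 / ‖T.altitudeFoot i - T.points i‖) • (T.altitudeFoot i - T.points i)

/-- The vector of the quadratic space that belongs to the side opposite to the vertex `i`: it
vanishes on this side, and the triangle lies in its half-plane. -/
def sideVector (T : Affine.Triangle ℝ Plane) (i : Fin 3) : QuadSpace :=
  (outerNormal T i, -inner ℝ (outerNormal T i) (T.altitudeFoot i))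

/-- The exchange matrix of the initial seed: up to sign, its entries are `2 cos` of the angles
between the sides, and the quiver is `0 → 1`, `0 → 2`, `1 → 2`, so that the base `0` is the source
and the leg `2` is the sink. -/
def initialMatrix (n : ℕ) : Matrix (Fin 3) (Fin 3) ℝ :=
  let α : ℝ := Real.pi / (2 * n + 1)
  !![0, 2 * Real.cos (n * α), 2 * Real.cos (n * α);
     -(2 * Real.cos (n * α)), 0, 2 * Real.cos α;
     -(2 * Real.cos (n * α)), -(2 * Real.cos α), 0]

/-- The initial seed. -/
def initialSeed (n : ℕ) (T : Affine.Triangle ℝ Plane) : Seed :=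
  Quotient.mk _ ⟨sideVector T, initialMatrix n⟩

/-- The belt line `b` passes through the feet of the altitudes on the source (side `0`) and on the
sink (side `2`); this is its parametrisation in the direction from the source to the sink. -/
def beltLine (T : Affine.Triangle ℝ Plane) (t : ℝ) : Plane :=
  AffineMap.lineMap (T.altitudeFoot 0) (T.altitudeFoot 2) t

/-- The unit vector parallel to the belt line, in the direction from the source to the sink. -/
def beltDirection (T : Affine.Triangle ℝ Plane) : Plane :=
  (1 / ‖T.altitudeFoot 2 - T.altitudeFoot 0‖) • (T.altitudeFoot 2 - T.altitudeFoot 0)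

/-- A vector is positive if its half-plane contains the reference point, which lies infinitely far
away on the belt line, in the direction from the source to the sink: the half-plane contains all
points of the belt line that are far enough in this direction. -/
def IsPositive (T : Affine.Triangle ℝ Plane) (v : QuadSpace) : Prop :=
  ∀ᶠ t : ℝ in atTop, beltLine T t ∈ halfPlane v

open Classical in
/-- Mutation of labelled seeds. -/
def LabelledSeed.mutate (T : Affine.Triangle ℝ Plane) (s : LabelledSeed) (k : Fin 3) :
    LabelledSeed where
  v i :=
    if i = k then -s.v i
    else if IsPositive T (s.v k) then
      if 0 < s.B i k then s.v i else s.v i - form (s.v i) (s.v k) • s.v k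
    else
      if s.B i k < 0 then s.v i else s.v i - form (s.v i) (s.v k) • s.v k
  B := mutateMatrix s.B k

/-- The seed `y` is obtained from the seed `x` by a single mutation. -/
def IsMutation (T : Affine.Triangle ℝ Plane) (x y : Seed) : Prop :=
  ∃ (s : LabelledSeed) (k : Fin 3), x = Quotient.mk _ s ∧ y = Quotient.mk _ (s.mutate T k)

/-- The seeds obtained from the initial seed by sequences of mutations. -/
def ExchangeVertex (n : ℕ) (T : Affine.Triangle ℝ Plane) : Type :=
  {x : Seed // Relation.ReflTransGen (IsMutation T) (initialSeed n T) x}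

/-- The initial seed as a vertex of the exchange graph. -/
def initialVertex (n : ℕ) (T : Affine.Triangle ℝ Plane) : ExchangeVertex n T :=
  ⟨initialSeed n T, Relation.ReflTransGen.refl⟩

/-- The exchange graph of the initial seed. -/
def exchangeGraph (n : ℕ) (T : Affine.Triangle ℝ Plane) : SimpleGraph (ExchangeVertex n T) :=
  SimpleGraph.fromRel fun x y => IsMutation T x.1 y.1

/-- The exchange graph is connected, so its graph distance is a genuine metric. -/
theorem exchangeGraph_connected (n : ℕ) (T : Affine.Triangle ℝ Plane) :
    (exchangeGraph n T).Connected := by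
  have key : ∀ x : Seed, ∀ hx : Relation.ReflTransGen (IsMutation T) (initialSeed n T) x,
      (exchangeGraph n T).Reachable (initialVertex n T) ⟨x, hx⟩ := by
    intro x hx
    induction hx with
    | refl => exact SimpleGraph.Reachable.refl _
    | @tail y z hy hyz ih =>
      by_cases h : y = z
      · subst h; exact ih
      · refine ih.trans (SimpleGraph.Adj.reachable ?_)
        refine (SimpleGraph.fromRel_adj _ _ _).2 ⟨fun e => h (congrArg Subtype.val e), Or.inl hyz⟩
  exact (SimpleGraph.connected_iff _).2
    ⟨fun x y => (key x.1 x.2).symm.trans (key y.1 y.2), ⟨initialVertex n T⟩⟩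

/-- The translation lattice `L`: the subgroup of `ℝ` generated by the lengths of all vectors that
translate one seed of the exchange graph into another one. -/
def translationLattice (n : ℕ) (T : Affine.Triangle ℝ Plane) : AddSubgroup ℝ :=
  AddSubgroup.closure
    {l : ℝ | ∃ (w : Plane) (x y : ExchangeVertex n T), x.1 = translate w y.1 ∧ l = ‖w‖}

/-- Quasi-isometries between sets with distance functions. -/
def IsQuasiIsometry {M₁ M₂ : Type*} (d₁ : M₁ → M₁ → ℝ) (d₂ : M₂ → M₂ → ℝ) (f : M₁ → M₂) : Prop :=
  (∃ a b : ℝ, 1 ≤ a ∧ 0 ≤ b ∧ ∀ x y,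
    1 / a * d₁ x y - b ≤ d₂ (f x) (f y) ∧ d₂ (f x) (f y) ≤ a * d₁ x y + b) ∧
  ∃ c : ℝ, 0 ≤ c ∧ ∀ z, ∃ x, d₂ z (f x) ≤ c

/-- The real-valued distance between two vertices of a graph. -/
def graphDist {M : Type*} (G : SimpleGraph M) (x y : M) : ℝ := (G.dist x y : ℝ)

/-- The graph `ℤ^r`: two lattice points are adjacent if their Euclidean distance is `1`. -/
def integerLatticeGraph (r : ℕ) : SimpleGraph (Fin r → ℤ) where
  Adj x y := ∑ i, (x i - y i) ^ 2 = 1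
  symm := ⟨fun x y h => by
    rw [← h]
    exact Finset.sum_congr rfl fun i _ => by ring⟩
  loopless := ⟨fun x h => by simp at h⟩

end

end AffineExchange

/-!
Up to the orientation of the plane, a seed of `Γ` is determined by two multiples `a α`, `b α` of
`α = π / (2 n + 1)`, where `1 ≤ a ≤ n` and `0 ≤ b ≤ n`, and by the point `O + p e` in which its
first line meets the belt line; `a α` and `b α` are the angles of its first two lines with the belt
line. If `a + b ≤ n`, mutations lead from `(a, b)` to `(a, a + b)`, where `p` is fixed, and to
`(a + b, b)`; if `a + b > n`, a mutation leads to `(2 n + 1 - (a + b), a)` with the orientation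
reversed. In the last two cases `p` changes by `K cos (b α) / (sin (a α) sin ((a + b) α))`, where
`K` only depends on the triangle. These moves and their inverses are all mutations.

Hence `K⁻¹ L` lies in the real subfield of the cyclotomic field of order `2 n + 1`, which bounds the
rank of `L` by `φ(2 n + 1) / 2`. Conversely, the moves carry out the subtractive Euclidean
algorithm, so that `(k, 0)` is reached for all `k ≤ n` coprime to `2 n + 1`. There the mutation
`(k, 0) ↦ (k, 0)` is the translation by the period `K / sin² (k α)`. The `φ(2 n + 1) / 2` numbers
`1 / sin² (k α)` are conjugate, and `1 / sin² α` exceeds the sum of the others. The conjugates of a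
rational relation between them thus form a diagonally dominant linear system, so the relation is
trivial and the rank is exactly `φ(2 n + 1) / 2`.

Since there are finitely many pairs `(a, b)`, the action of `L` is cocompact, and the statements on
quasi-isometries follow from the Švarc–Milnor lemma.
-/

namespace AffineExchange

open Real Filter EuclideanGeometry

noncomputable section

section CoarseGeometry

variable {A M N : Type*} {G : SimpleGraph M} {H : SimpleGraph N}

theorem edist_iso_apply_le (φ : G ≃g H) (x y : M) : H.edist (φ x) (φ y) ≤ G.edist x y := by
  rw [G.edist_eq_sInf]
  refine le_sInf ?_
  rintro _ ⟨p, rfl⟩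
  exact (p.map φ.toHom).edist_le.trans_eq (by rw [SimpleGraph.Walk.length_map])

theorem dist_iso_apply (φ : G ≃g H) (x y : M) : H.dist (φ x) (φ y) = G.dist x y := by
  refine congrArg ENat.toNat ((edist_iso_apply_le φ x y).antisymm ?_)
  simpa only [RelIso.symm_apply_apply] using edist_iso_apply_le φ.symm (φ x) (φ y)

theorem dist_map_le_mul_dist (hG : G.Connected) (hH : H.Connected) {f : M → N} {C : ℕ}
    (hf : ∀ x y, G.Adj x y → H.dist (f x) (f y) ≤ C) (x y : M) :
    H.dist (f x) (f y) ≤ C * G.dist x y := by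
  have dist_le_length : ∀ {u v : M} (p : G.Walk u v), H.dist (f u) (f v) ≤ C * p.length := by
    intro u v p
    induction p with
    | nil => simp
    | cons h p ih =>
      rw [SimpleGraph.Walk.length_cons, mul_add_one, add_comm]
      exact hH.dist_triangle.trans (add_le_add (hf _ _ h) ih)
  obtain ⟨p, hp⟩ := hG.exists_walk_length_eq_dist x y
  exact hp ▸ dist_le_length p

theorem isQuasiIsometry_of_coarse_inverse (hG : G.Connected) {f : M → N} {g : N → M}
    {C₁ C₂ D E : ℕ}
    (hf : ∀ x y, H.dist (f x) (f y) ≤ C₁ * G.dist x y)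
    (hg : ∀ x y, G.dist (g x) (g y) ≤ C₂ * H.dist x y)
    (hfg : ∀ x, H.dist x (f (g x)) ≤ D) (hgf : ∀ x, G.dist x (g (f x)) ≤ E) :
    IsQuasiIsometry (graphDist G) (graphDist H) f := by
  refine ⟨⟨C₁ + C₂ + 1, 2 * E, le_add_of_nonneg_left (by positivity), by positivity,
    fun x y => ⟨?_, ?_⟩⟩, D, by positivity, fun z => ⟨g z, Nat.cast_le.2 (hfg z)⟩⟩
  · have lower : G.dist x y ≤ C₂ * H.dist (f x) (f y) + 2 * E :=
      calc G.dist x y ≤ G.dist x (g (f x)) + (G.dist (g (f x)) (g (f y)) + G.dist (g (f y)) y) :=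
            hG.dist_triangle.trans (by gcongr; exact hG.dist_triangle)
        _ ≤ E + (C₂ * H.dist (f x) (f y) + E) := by
            gcongr
            exacts [hgf x, hg _ _, SimpleGraph.dist_comm.trans_le (hgf y)]
        _ = C₂ * H.dist (f x) (f y) + 2 * E := by ring
    rw [sub_le_iff_le_add, one_div, inv_mul_le_iff₀ (by positivity)]
    calc (G.dist x y : ℝ) ≤ C₂ * H.dist (f x) (f y) + 2 * E := mod_cast lower
      _ ≤ C₂ * H.dist (f x) (f y) + 2 * E
          + ((C₁ + 1) * H.dist (f x) (f y) + (C₁ + C₂) * (2 * E)) :=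
        le_add_of_nonneg_right (by positivity)
      _ = (C₁ + C₂ + 1) * (graphDist H (f x) (f y) + 2 * E) := by rw [graphDist]; ring
  · calc (H.dist (f x) (f y) : ℝ) ≤ C₁ * G.dist x y := mod_cast hf x y
      _ ≤ C₁ * G.dist x y + ((C₂ + 1) * G.dist x y + 2 * E) :=
        le_add_of_nonneg_right (by positivity)
      _ = (C₁ + C₂ + 1) * graphDist G x y + 2 * E := by rw [graphDist]; ring

theorem finite_setOf_dist_le (hG : G.Connected) (hfin : ∀ x, {y | G.Adj x y}.Finite) (x : M)
    (m : ℕ) : {y | G.dist x y ≤ m}.Finite := by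
  have finite_walk_length_le : ∀ (m : ℕ) (x : M), {y | ∃ p : G.Walk x y, p.length ≤ m}.Finite := by
    intro m
    induction m with
    | zero =>
      refine fun x => (Set.finite_singleton x).subset ?_
      rintro y ⟨p, hp⟩
      exact (SimpleGraph.Walk.eq_of_length_eq_zero (Nat.le_zero.1 hp)).symm
    | succ m ih =>
      refine fun x => ((Set.finite_singleton x).union ((hfin x).biUnion fun z _ => ih z)).subset ?_
      rintro y ⟨_ | ⟨h, p⟩, hp⟩
      · exact Or.inl rfl
      · exact Or.inr (Set.mem_biUnion h ⟨p, Nat.le_of_succ_le_succ hp⟩)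
  refine (finite_walk_length_le m x).subset fun y hy => ?_
  obtain ⟨p, hp⟩ := hG.exists_walk_length_eq_dist x y
  exact ⟨p, hp.trans_le hy⟩

variable [AddGroup A] {K : SimpleGraph A}

/-- A graph on an additive group is translation invariant if left translations preserve
adjacency; Cayley graphs and the graph `ℤ^r` have this property. -/
def IsTranslationInvariant (K : SimpleGraph A) : Prop :=
  ∀ d u v, K.Adj u v → K.Adj (d + u) (d + v)

namespace IsTranslationInvariant

/-- Left translation by `d`, as an automorphism of a translation invariant graph. -/
def addLeft (hK : IsTranslationInvariant K) (d : A) : K ≃g K where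
  toEquiv := Equiv.addLeft d
  map_rel_iff' := fun {u v} => ⟨fun h => by simpa using hK (-d) _ _ h, hK d u v⟩

theorem dist_eq_dist_neg_add (hK : IsTranslationInvariant K) (u v : A) :
    K.dist u v = K.dist 0 (-u + v) :=
  (dist_iso_apply (hK.addLeft (-u)) u v).symm.trans (congrArg (K.dist · _) (neg_add_cancel u))

theorem reachable_add (hK : IsTranslationInvariant K) (d : A) {u v : A} (h : K.Reachable u v) :
    K.Reachable (d + u) (d + v) :=
  h.map (hK.addLeft d).toHom

theorem connected_of_closure_eq_top (hK : IsTranslationInvariant K) {S : Set A}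
    (hS : ∀ s ∈ S, K.Reachable 0 s) (hcl : AddSubgroup.closure S = ⊤) : K.Connected := by
  have reachable_zero : ∀ x, K.Reachable 0 x := fun x => by
    induction (hcl ▸ AddSubgroup.mem_top x : x ∈ AddSubgroup.closure S)
      using AddSubgroup.closure_induction with
    | mem s hs => exact hS s hs
    | zero => rfl
    | add x y _ _ hx hy => exact hx.trans (by simpa using hK.reachable_add x hy)
    | neg x _ hx => simpa using (hK.reachable_add (-x) hx).symm
  exact (SimpleGraph.connected_iff _).2
    ⟨fun x y => (reachable_zero x).symm.trans (reachable_zero y), ⟨0⟩⟩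

end IsTranslationInvariant

section SvarcMilnor

open Multiplicative (ofAdd)

variable (τ : Multiplicative A →* (G ≃g G))

theorem dist_orbit (u v : A) (x : M) :
    G.dist (τ (ofAdd u) x) (τ (ofAdd v) x) = G.dist x (τ (ofAdd (-u + v)) x) := by
  rw [← dist_iso_apply (τ (ofAdd u)) x, ← RelIso.mul_apply, ← map_mul, ← ofAdd_add,
    add_neg_cancel_left]

theorem exists_dist_orbit_le_mul_dist (hK : IsTranslationInvariant K) (hKc : K.Connected)
    (hfin : {s | K.Adj 0 s}.Finite) (hG : G.Connected) (x : M) :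
    ∃ C : ℕ, ∀ u v, G.dist (τ (ofAdd u) x) (τ (ofAdd v) x) ≤ C * K.dist u v := by
  obtain ⟨C, hC⟩ := (hfin.image fun s => G.dist x (τ (ofAdd s) x)).bddAbove
  refine ⟨C, dist_map_le_mul_dist (f := fun u => τ (ofAdd u) x) hKc hG fun u v huv => ?_⟩
  rw [dist_orbit]
  exact hC ⟨-u + v, by simpa using hK (-u) u v huv, rfl⟩

theorem exists_dist_le_of_dist_orbit_le (hK : IsTranslationInvariant K) {x : M} {D : ℕ}
    (proper : {w | G.dist x (τ (ofAdd w) x) ≤ D}.Finite) :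
    ∃ C : ℕ, ∀ u v, G.dist (τ (ofAdd u) x) (τ (ofAdd v) x) ≤ D → K.dist u v ≤ C := by
  obtain ⟨C, hC⟩ := (proper.image fun w => K.dist 0 w).bddAbove
  refine ⟨C, fun u v huv => ?_⟩
  rw [hK.dist_eq_dist_neg_add]
  exact hC ⟨-u + v, (dist_orbit τ u v x).symm.trans_le huv, rfl⟩

theorem exists_dist_orbit_le {F : Set M} (hF : F.Finite)
    (hcov : ∀ x, ∃ y ∈ F, ∃ w, τ (ofAdd w) y = x) (x₀ : M) :
    ∃ D : ℕ, ∀ x, ∃ w, G.dist x (τ (ofAdd w) x₀) ≤ D := by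
  obtain ⟨D, hD⟩ := (hF.image fun y => G.dist y x₀).bddAbove
  refine ⟨D, fun x => ?_⟩
  obtain ⟨y, hy, w, rfl⟩ := hcov x
  exact ⟨w, (dist_iso_apply _ y x₀).trans_le (hD ⟨y, hy, rfl⟩)⟩

theorem svarc_milnor (hK : IsTranslationInvariant K) (hKc : K.Connected)
    (hfin : {s | K.Adj 0 s}.Finite) (hG : G.Connected)
    (proper : ∀ (x : M) (m : ℕ), {w | G.dist x (τ (ofAdd w) x) ≤ m}.Finite)
    (cocompact : ∃ F : Set M, F.Finite ∧ ∀ x, ∃ y ∈ F, ∃ w, τ (ofAdd w) y = x) (x₀ : M) :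
    IsQuasiIsometry (graphDist K) (graphDist G) (fun w => τ (ofAdd w) x₀) ∧
      ∃ g : M → A, IsQuasiIsometry (graphDist G) (graphDist K) g := by
  obtain ⟨F, hF, hcov⟩ := cocompact
  obtain ⟨D, hD⟩ := exists_dist_orbit_le τ hF hcov x₀
  choose g hg using hD
  obtain ⟨C₁, hC₁⟩ := exists_dist_orbit_le_mul_dist τ hK hKc hfin hG x₀
  obtain ⟨C₂, hC₂⟩ := exists_dist_le_of_dist_orbit_le τ hK (proper x₀ (D + (1 + D)))
  have g_lipschitz : ∀ x y, K.dist (g x) (g y) ≤ C₂ * G.dist x y := by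
    refine dist_map_le_mul_dist hG hKc fun x y hxy => hC₂ _ _ ?_
    calc G.dist (τ (ofAdd (g x)) x₀) (τ (ofAdd (g y)) x₀)
        ≤ G.dist (τ (ofAdd (g x)) x₀) x + (G.dist x y + G.dist y (τ (ofAdd (g y)) x₀)) :=
          hG.dist_triangle.trans (by gcongr; exact hG.dist_triangle)
      _ ≤ D + (1 + D) := by
          gcongr
          exacts [SimpleGraph.dist_comm.trans_le (hg x), (SimpleGraph.dist_eq_one_iff_adj.2 hxy).le,
            hg y]
  have g_orbit : ∀ w, K.dist w (g (τ (ofAdd w) x₀)) ≤ C₂ := fun w =>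
    hC₂ _ _ ((hg _).trans (Nat.le_add_right _ _))
  exact ⟨isQuasiIsometry_of_coarse_inverse hKc hC₁ g_lipschitz hg g_orbit,
    g, isQuasiIsometry_of_coarse_inverse hG g_lipschitz hC₁ g_orbit hg⟩

end SvarcMilnor

theorem isTranslationInvariant_addCayley (S : Set A) :
    IsTranslationInvariant (SimpleGraph.addCayley S) :=
  fun _ _ _ => SimpleGraph.addCayley_adj_add_iff_right.2

theorem addCayley_connected {S : Set A} (hS : AddSubgroup.closure S = ⊤) :
    (SimpleGraph.addCayley S).Connected := by
  refine (isTranslationInvariant_addCayley S).connected_of_closure_eq_top (fun s hs => ?_) hS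
  by_cases h0 : s = 0
  · rw [h0]
  · exact ((SimpleGraph.addCayley_adj' S 0 s).2 ⟨Ne.symm h0, s, hs, by simp⟩).reachable

theorem finite_addCayley_adj_zero {S : Set A} (hS : S.Finite) :
    {s | (SimpleGraph.addCayley S).Adj 0 s}.Finite := by
  refine (hS.union (hS.image fun s => -s)).subset fun s hs => ?_
  obtain ⟨-, g, hg, h | h⟩ := (SimpleGraph.addCayley_adj' S 0 s).1 hs
  · exact Or.inl (by rwa [← h, zero_add])
  · exact Or.inr ⟨g, hg, (eq_neg_of_add_eq_zero_left h.symm).symm⟩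

variable (r : ℕ)

theorem isTranslationInvariant_integerLatticeGraph :
    IsTranslationInvariant (integerLatticeGraph r) := fun d u v h => by
  simpa [integerLatticeGraph] using h

theorem integerLatticeGraph_connected : (integerLatticeGraph r).Connected := by
  refine (isTranslationInvariant_integerLatticeGraph r).connected_of_closure_eq_top
    (S := Set.range fun i => Pi.single i 1) ?_ (eq_top_iff.2 fun x _ => ?_)
  · rintro _ ⟨i, rfl⟩
    refine SimpleGraph.Adj.reachable ?_
    simp [integerLatticeGraph, Pi.single_apply, ite_pow]
  · rw [← Finset.univ_sum_single x]
    refine AddSubgroup.sum_mem _ fun i _ => ?_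
    have single_eq : (Pi.single i (x i) : Fin r → ℤ) = x i • Pi.single i 1 := by
      rw [← Pi.single_smul, smul_eq_mul, mul_one]
    rw [single_eq]
    exact AddSubgroup.zsmul_mem _ (AddSubgroup.subset_closure (Set.mem_range_self i)) _

theorem finite_integerLatticeGraph_adj_zero : {s | (integerLatticeGraph r).Adj 0 s}.Finite := by
  refine (Set.Finite.pi' (t := fun _ : Fin r => Set.Icc (-1 : ℤ) 1)
    fun _ => Set.finite_Icc _ _).subset fun s hs i => ?_
  have sum_sq : ∑ i, s i ^ 2 = 1 := by simpa [integerLatticeGraph] using hs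
  have sq_le_one : s i ^ 2 ≤ 1 :=
    sum_sq ▸ Finset.single_le_sum (fun j _ => sq_nonneg (s j)) (Finset.mem_univ i)
  exact abs_le.1 ((sq_le_one_iff_abs_le_one _).1 sq_le_one)

theorem exists_isQuasiIsometry_integerLatticeGraph {B : Type*} [AddCommGroup B]
    [Module.Finite ℤ B] [Module.Free ℤ B]
    (τ : Multiplicative B →* (G ≃g G)) (hG : G.Connected)
    (proper : ∀ (x : M) (m : ℕ), {w | G.dist x (τ (.ofAdd w) x) ≤ m}.Finite)
    (cocompact : ∃ F : Set M, F.Finite ∧ ∀ x, ∃ y ∈ F, ∃ w, τ (.ofAdd w) y = x)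
    (hr : Module.finrank ℤ B = r) :
    ∃ g : M → Fin r → ℤ, IsQuasiIsometry (graphDist G) (graphDist (integerLatticeGraph r)) g := by
  let φ : (Fin r → ℤ) ≃+ B := (Module.finBasisOfFinrankEq ℤ B hr).equivFun.symm.toAddEquiv
  obtain ⟨x₀⟩ := hG.nonempty
  refine (svarc_milnor (τ.comp φ.toAddMonoidHom.toMultiplicative)
    (isTranslationInvariant_integerLatticeGraph r) (integerLatticeGraph_connected r)
    (finite_integerLatticeGraph_adj_zero r) hG (fun x m => ?_) ?_ x₀).2
  · exact (proper x m).preimage φ.injective.injOn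
  · refine cocompact.imp fun F hF => ⟨hF.1, fun x => ?_⟩
    obtain ⟨y, hy, w, hw⟩ := hF.2 x
    exact ⟨y, hy, φ.symm w, by simpa using hw⟩

end CoarseGeometry

variable {T : Affine.Triangle ℝ Plane}

section Mutation

attribute [ext] LabelledSeed

theorem mutateMatrix_mutateMatrix (B : Matrix (Fin 3) (Fin 3) ℝ) (k : Fin 3) :
    mutateMatrix (mutateMatrix B k) k = B := by
  ext i j
  by_cases h : i = k ∨ j = k
  · simp only [mutateMatrix, h, if_true, neg_neg]
  · simp only [mutateMatrix, h, or_true, true_or, if_true, if_false, abs_neg]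
    ring

namespace LabelledSeed

variable (s : LabelledSeed) (k : Fin 3)

/-- The seed with renumbered entries; two labelled seeds have the same class if and only if one is
a renumbering of the other. -/
def permute (σ : Equiv.Perm (Fin 3)) (s : LabelledSeed) : LabelledSeed where
  v i := s.v (σ i)
  B i j := s.B (σ i) (σ j)

theorem mk_permute (σ : Equiv.Perm (Fin 3)) :
    (Quotient.mk _ (s.permute σ) : Seed) = Quotient.mk _ s :=
  (Quotient.sound ⟨σ, fun _ => rfl, fun _ _ => rfl⟩ : (Quotient.mk _ s : Seed) = _).symm

theorem mutate_v_self : (s.mutate T k).v k = -s.v k := if_pos rfl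

variable {s k}

theorem mutate_v_of_isPositive (hk : IsPositive T (s.v k)) {i : Fin 3} (hik : i ≠ k) :
    (s.mutate T k).v i =
      if 0 < s.B i k then s.v i else s.v i - form (s.v i) (s.v k) • s.v k := by
  simp only [mutate, if_neg hik, if_pos hk]

theorem mutate_v_of_not_isPositive (hk : ¬ IsPositive T (s.v k)) {i : Fin 3} (hik : i ≠ k) :
    (s.mutate T k).v i =
      if s.B i k < 0 then s.v i else s.v i - form (s.v i) (s.v k) • s.v k := by
  simp only [mutate, if_neg hik, if_neg hk]

variable (s k)

theorem mutate_permute (σ : Equiv.Perm (Fin 3)) :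
    (s.permute σ).mutate T k = (s.mutate T (σ k)).permute σ := by
  refine LabelledSeed.ext (funext fun i => ?_) (funext₂ fun i j => ?_)
  · simp only [mutate, permute, EmbeddingLike.apply_eq_iff_eq]
    congr
  · simp only [mutate, mutateMatrix, permute, EmbeddingLike.apply_eq_iff_eq]

theorem sub_form_neg_smul_neg (v w : QuadSpace) :
    v - form v (-w) • -w = v - form v w • w := by
  simp only [form, Prod.fst_neg, inner_neg_right, neg_smul_neg]

theorem sub_form_sub_form {v w : QuadSpace} (hw : form w w = 2) :
    v - form v w • w - form (v - form v w • w) w • w = v := by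
  have form_reflection : form (v - form v w • w) w = -form v w := by
    simp only [form, Prod.fst_sub, Prod.smul_fst, inner_sub_left, real_inner_smul_left] at hw ⊢
    rw [hw]
    ring
  rw [form_reflection]
  module

variable {s k}

theorem mutate_mutate (hk : form (s.v k) (s.v k) = 2)
    (hpos : IsPositive T (-s.v k) ↔ ¬ IsPositive T (s.v k)) :
    (s.mutate T k).mutate T k = s := by
  refine LabelledSeed.ext (funext fun i => ?_) (mutateMatrix_mutateMatrix s.B k)
  have B_neg : (s.mutate T k).B i k = -s.B i k := if_pos (Or.inr rfl)
  by_cases hik : i = k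
  · rw [hik, mutate_v_self, mutate_v_self, neg_neg]
  by_cases h : IsPositive T (s.v k)
  · have hneg : ¬ IsPositive T ((s.mutate T k).v k) := by rw [mutate_v_self, hpos, not_not]; exact h
    rw [mutate_v_of_not_isPositive hneg hik, mutate_v_of_isPositive h hik, mutate_v_self, B_neg,
      sub_form_neg_smul_neg]
    by_cases hB : 0 < s.B i k
    · rw [if_pos hB, if_pos (neg_neg_of_pos hB)]
    · rw [if_neg hB, if_neg (fun h' => hB (neg_neg_iff_pos.1 h')), sub_form_sub_form hk]
  · have hneg : IsPositive T ((s.mutate T k).v k) := by rwa [mutate_v_self, hpos]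
    rw [mutate_v_of_isPositive hneg hik, mutate_v_of_not_isPositive h hik, mutate_v_self, B_neg,
      sub_form_neg_smul_neg]
    by_cases hB : s.B i k < 0
    · rw [if_pos hB, if_pos (neg_pos.2 hB)]
    · rw [if_neg hB, if_neg (fun h' => hB (neg_pos.1 h')), sub_form_sub_form hk]

end LabelledSeed

theorem mk_mutate_of_eq_permute {s t : LabelledSeed} {k : Fin 3} {σ : Equiv.Perm (Fin 3)}
    (hk : form (s.v k) (s.v k) = 2) (hpos : IsPositive T (-s.v k) ↔ ¬ IsPositive T (s.v k))
    (h : s.mutate T k = t.permute σ) :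
    (Quotient.mk _ (s.mutate T k) : Seed) = Quotient.mk _ t ∧
      (Quotient.mk _ (t.mutate T (σ k)) : Seed) = Quotient.mk _ s := by
  have h' : (t.mutate T (σ k)).permute σ = s := by
    rw [← LabelledSeed.mutate_permute, ← h, LabelledSeed.mutate_mutate hk hpos]
  rw [← LabelledSeed.mk_permute (t.mutate T (σ k)) σ, h', h, LabelledSeed.mk_permute]
  exact ⟨rfl, rfl⟩

theorem isMutation_mk_iff (s : LabelledSeed) (y : Seed) :
    IsMutation T (Quotient.mk _ s) y ↔ ∃ k, y = Quotient.mk _ (s.mutate T k) := by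
  constructor
  · rintro ⟨s', k, h, rfl⟩
    obtain ⟨σ, hv, hB⟩ := Quotient.exact h
    obtain rfl : s' = s.permute σ := LabelledSeed.ext (funext hv) (funext₂ hB)
    exact ⟨σ k, by rw [LabelledSeed.mutate_permute, LabelledSeed.mk_permute]⟩
  · rintro ⟨k, rfl⟩
    exact ⟨s, k, rfl, rfl⟩

end Mutation

theorem eventually_mul_add_neg_iff (a c : ℝ) :
    (∀ᶠ t : ℝ in atTop, a * t + c < 0) ↔ a < 0 ∨ a = 0 ∧ c < 0 := by
  rcases lt_trichotomy a 0 with ha | rfl | ha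
  · refine iff_of_true ?_ (Or.inl ha)
    exact (tendsto_atBot_add_const_right _ c
      (tendsto_id.const_mul_atTop_of_neg ha)).eventually_lt_atBot 0
  · simp only [zero_mul, zero_add, eventually_const, lt_irrefl, true_and, false_or]
  · refine iff_of_false (fun h => ?_) (by rintro (h | ⟨h, -⟩) <;> linarith)
    obtain ⟨t, hneg, hpos⟩ := (h.and ((tendsto_atTop_add_const_right _ c
      (tendsto_id.const_mul_atTop ha)).eventually_ge_atTop 0)).exists
    exact hneg.not_ge hpos

/-- An orthonormal frame whose first vector is the direction of the belt line and whose origin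
lies on the belt line, together with the unit of length `K` in which the seeds are measured. -/
structure BeltFrame (T : Affine.Triangle ℝ Plane) where
  /-- the direction of the belt line -/
  e : Plane
  /-- the normal of the belt line -/
  f : Plane
  /-- the origin -/
  O : Plane
  /-- the unit of length -/
  K : ℝ
  /-- the speed of the parametrisation of the belt line -/
  r : ℝ
  inner_e_e : inner ℝ e e = (1 : ℝ)
  inner_f_f : inner ℝ f f = (1 : ℝ)
  inner_e_f : inner ℝ e f = (0 : ℝ)
  K_pos : 0 < K
  r_pos : 0 < r
  beltLine_eq : ∀ t, beltLine T t = O + (t * r) • e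

namespace BeltFrame

/-- The mirror image of a frame in the belt line. -/
def flip (F : BeltFrame T) : BeltFrame T where
  e := F.e
  f := -F.f
  O := F.O
  K := F.K
  r := F.r
  inner_e_e := F.inner_e_e
  inner_f_f := by simpa using F.inner_f_f
  inner_e_f := by simpa using F.inner_e_f
  K_pos := F.K_pos
  r_pos := F.r_pos
  beltLine_eq := F.beltLine_eq

theorem flip_flip (F : BeltFrame T) : F.flip.flip = F := by
  simp [flip]

/-- The vector of length `√2` that makes the angle `θ` with `-f`. In frame coordinates it is
`√2 (sin θ, -cos θ)`, so it is perpendicular to the lines that make the angle `θ` with the belt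
line. -/
def normal (F : BeltFrame T) (θ : ℝ) : Plane := √2 • (sin θ • F.e - cos θ • F.f)

/-- The vector of the quadratic space with linear part `normal θ` and value `√2 c` at the
origin. -/
def vec (F : BeltFrame T) (θ c : ℝ) : QuadSpace :=
  (F.normal θ, √2 * c - inner ℝ (F.normal θ) F.O)

variable (F : BeltFrame T)

theorem vec_congr {θ θ' c c' : ℝ} (hs : sin θ = sin θ') (hc : cos θ = cos θ') (h : c = c') :
    F.vec θ c = F.vec θ' c' := by
  simp only [vec, normal, hs, hc, h]

theorem vec_add_two_pi (θ c : ℝ) : F.vec (θ + 2 * π) c = F.vec θ c :=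
  F.vec_congr (sin_add_two_pi θ) (cos_add_two_pi θ) rfl

theorem neg_vec (θ c : ℝ) : -F.vec θ c = F.vec (θ + π) (-c) := by
  have normal_add_pi : F.normal (θ + π) = -F.normal θ := by
    simp only [normal, sin_add_pi, cos_add_pi]
    module
  simp only [vec, normal_add_pi, Prod.neg_mk, inner_neg_left, mul_neg, neg_sub, sub_neg_eq_add,
    neg_add_eq_sub]

theorem flip_normal (θ : ℝ) : F.flip.normal θ = F.normal (π - θ) := by
  simp only [normal, sin_pi_sub, cos_pi_sub, flip]
  module

theorem flip_vec (θ c : ℝ) : F.flip.vec θ c = F.vec (π - θ) c := by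
  simp only [vec, flip_normal]
  rfl

theorem inner_normal_e (θ : ℝ) : inner ℝ (F.normal θ) F.e = √2 * sin θ := by
  simp only [normal, real_inner_smul_left, inner_sub_left, F.inner_e_e, real_inner_comm F.e F.f,
    F.inner_e_f, mul_one, mul_zero, sub_zero]

theorem inner_normal_f (θ : ℝ) : inner ℝ (F.normal θ) F.f = -(√2 * cos θ) := by
  simp only [normal, real_inner_smul_left, inner_sub_left, F.inner_e_f, F.inner_f_f, mul_one,
    mul_zero, zero_sub, mul_neg]

theorem form_vec (θ c θ' c' : ℝ) : form (F.vec θ c) (F.vec θ' c') = 2 * cos (θ - θ') := by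
  have inner_eq : inner ℝ (F.normal θ) (F.normal θ') = √2 * √2 * cos (θ - θ') := by
    rw [normal.eq_1 F θ', real_inner_smul_right, inner_sub_right, real_inner_smul_right,
      real_inner_smul_right, inner_normal_e, inner_normal_f, cos_sub]
    ring
  rwa [mul_self_sqrt zero_le_two] at inner_eq

theorem vec_sub_form (θ c θ' c' : ℝ) :
    F.vec θ c - form (F.vec θ c) (F.vec θ' c') • F.vec θ' c' =
      F.vec (2 * θ' - θ + π) (c - 2 * cos (θ - θ') * c') := by
  obtain ⟨d, rfl⟩ : ∃ d, θ = θ' + d := ⟨θ - θ', by ring⟩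
  have normal_reflect : F.normal (2 * θ' - (θ' + d) + π) =
      F.normal (θ' + d) - (2 * cos (θ' + d - θ')) • F.normal θ' := by
    simp only [normal, show 2 * θ' - (θ' + d) = θ' - d by ring, add_sub_cancel_left, sin_add_pi,
      cos_add_pi]
    simp only [sin_sub, cos_sub, sin_add, cos_add]
    module
  rw [form_vec]
  simp only [vec, normal_reflect, Prod.smul_mk, Prod.mk_sub_mk, inner_sub_left,
    real_inner_smul_left, smul_eq_mul]
  congr 1
  ring

theorem isPositive_vec_iff (θ c : ℝ) :
    IsPositive T (F.vec θ c) ↔ sin θ < 0 ∨ sin θ = 0 ∧ c < 0 := by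
  have evalAt_beltLine : ∀ t, evalAt (F.vec θ c) (beltLine T t) = √2 * (sin θ * F.r * t + c) := by
    intro t
    simp only [F.beltLine_eq, evalAt, vec, inner_add_right, real_inner_smul_right,
      F.inner_normal_e]
    ring
  have sqrt_two_mul_neg : ∀ x : ℝ, √2 * x < 0 ↔ x < 0 := fun x =>
    smul_neg_iff_of_pos_left (sqrt_pos.2 zero_lt_two)
  simp only [IsPositive, halfPlane, Set.mem_ofPred_eq, evalAt_beltLine, sqrt_two_mul_neg,
    eventually_mul_add_neg_iff, mul_neg_iff, mul_eq_zero, F.r_pos, F.r_pos.ne', F.r_pos.not_gt,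
    and_false, and_true, or_false, false_or]

theorem isPositive_neg_vec_iff {θ c : ℝ} (h : sin θ ≠ 0 ∨ c ≠ 0) :
    IsPositive T (-F.vec θ c) ↔ ¬ IsPositive T (F.vec θ c) := by
  rw [neg_vec, isPositive_vec_iff, isPositive_vec_iff, sin_add_pi]
  rcases lt_trichotomy (sin θ) 0 with hs | hs | hs
  · simp [hs, hs.le, hs.ne]
  · simp [hs, (h.resolve_left (not_not.2 hs)).symm.le_iff_lt]
  · simp [hs, hs.le, hs.ne']

theorem translateVector_vec (t θ c : ℝ) :
    translateVector (t • F.e) (F.vec θ c) = F.vec θ (c - sin θ * t) := by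
  simp only [translateVector, vec, real_inner_smul_right, F.inner_normal_e]
  congr 1
  ring

end BeltFrame

namespace BeltFrame

/-- The exchange matrix of the seed with angles `A` and `B`. -/
def stateMatrix (A B : ℝ) : Matrix (Fin 3) (Fin 3) ℝ :=
  !![0, -(2 * cos (A + B)), 2 * cos B;
     2 * cos (A + B), 0, -(2 * cos A);
     -(2 * cos B), 2 * cos A, 0]

variable (F : BeltFrame T)

/-- The labelled seed with angles `A` and `B` at position `p`: the lines of the first two vectors
make the angles `-A` and `B` with the belt line, and the first line meets it at `O + p e`. -/
def state (A B p : ℝ) : LabelledSeed where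
  v := ![F.vec (-A) (p * sin A),
    F.vec B (-(p * sin B) + F.K * cos (A + B) / sin A),
    F.vec (π + (B - A)) (p * sin (B - A) - F.K * cos B / sin A)]
  B := stateMatrix A B

/-- The distance, in units of length, between the positions of the two states that are related by
a mutation which moves the first line. -/
def displacement (A B : ℝ) : ℝ := cos B / (sin A * sin (A + B))

theorem state_v_zero (A B p : ℝ) : (F.state A B p).v 0 = F.vec (-A) (p * sin A) := rfl

theorem state_v_one (A B p : ℝ) :
    (F.state A B p).v 1 = F.vec B (-(p * sin B) + F.K * cos (A + B) / sin A) := rfl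

theorem state_v_two (A B p : ℝ) :
    (F.state A B p).v 2 = F.vec (π + (B - A)) (p * sin (B - A) - F.K * cos B / sin A) := rfl

theorem form_state_v_self (A B p : ℝ) (i : Fin 3) :
    form ((F.state A B p).v i) ((F.state A B p).v i) = 2 := by
  have form_vec_self : ∀ θ c, form (F.vec θ c) (F.vec θ c) = 2 := fun θ c => by
    rw [form_vec, sub_self, cos_zero, mul_one]
  fin_cases i <;> exact form_vec_self _ _

theorem translate_state (t A B p : ℝ) :
    (F.state A B p).translate (t • F.e) = F.state A B (p + t) := by
  refine LabelledSeed.ext (funext fun i => ?_) rfl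
  match i with
  | 0 =>
    refine (F.translateVector_vec t _ _).trans (F.vec_congr rfl rfl ?_)
    rw [sin_neg]
    ring
  | 1 =>
    refine (F.translateVector_vec t _ _).trans (F.vec_congr rfl rfl ?_)
    ring
  | 2 =>
    refine (F.translateVector_vec t _ _).trans (F.vec_congr rfl rfl ?_)
    rw [add_comm π, sin_add_pi]
    ring

section Positivity

variable {A B : ℝ} (p : ℝ)

theorem isPositive_state_v_zero (hA : 0 < sin A) : IsPositive T ((F.state A B p).v 0) := by
  rw [state_v_zero, isPositive_vec_iff, sin_neg]
  exact Or.inl (neg_neg_of_pos hA)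

theorem isPositive_neg_state_v_zero (hA : sin A ≠ 0) :
    IsPositive T (-(F.state A B p).v 0) ↔ ¬ IsPositive T ((F.state A B p).v 0) :=
  F.isPositive_neg_vec_iff (Or.inl (by rwa [sin_neg, neg_ne_zero]))

theorem isPositive_state_v_two_iff (hA : 0 < A) (hA' : A < π / 2) (hB : 0 ≤ B) (hB' : B < π / 2) :
    IsPositive T ((F.state A B p).v 2) ↔ A ≤ B := by
  rw [state_v_two, isPositive_vec_iff, add_comm π, sin_add_pi, neg_lt_zero, neg_eq_zero]
  rcases lt_trichotomy A B with h | rfl | h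
  · exact iff_of_true (Or.inl (sin_pos_of_pos_of_lt_pi (by linarith) (by linarith))) h.le
  · have hsin : 0 < sin A := sin_pos_of_pos_of_lt_pi hA (by linarith)
    have hcos : 0 < cos A := cos_pos_of_mem_Ioo ⟨by linarith, hA'⟩
    have hK : 0 < F.K * cos A / sin A := div_pos (mul_pos F.K_pos hcos) hsin
    simpa using hK
  · have hsin : sin (B - A) < 0 := sin_neg_of_neg_of_neg_pi_lt (by linarith) (by linarith)
    exact iff_of_false (by rintro (h' | ⟨h', -⟩) <;> linarith) h.not_ge

theorem isPositive_neg_state_v_two (hA : 0 < A) (hA' : A < π / 2) (hB : 0 ≤ B) (hB' : B < π / 2) :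
    IsPositive T (-(F.state A B p).v 2) ↔ ¬ IsPositive T ((F.state A B p).v 2) := by
  refine F.isPositive_neg_vec_iff (or_iff_not_imp_left.2 fun h => ?_)
  rw [not_not, add_comm π, sin_add_pi, neg_eq_zero,
    sin_eq_zero_iff_of_lt_of_lt (by linarith) (by linarith)] at h
  have hsin : 0 < sin A := sin_pos_of_pos_of_lt_pi hA (by linarith)
  have hcos : 0 < cos B := cos_pos_of_mem_Ioo ⟨by linarith, hB'⟩
  rw [h, sin_zero, mul_zero, zero_sub, neg_ne_zero]
  exact (div_pos (mul_pos F.K_pos hcos) hsin).ne'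

end Positivity

section Up

variable {A B : ℝ} (p : ℝ)

theorem mutateMatrix_stateMatrix_two (hA : 0 < cos A) (hB : 0 < cos B) :
    mutateMatrix (stateMatrix A B) 2 =
      !![0, 2 * cos (B - A), -(2 * cos B);
         -(2 * cos (B - A)), 0, 2 * cos A;
         2 * cos B, -(2 * cos A), 0] := by
  have cos_sub_eq : cos (B - A) = 2 * cos A * cos B - cos (A + B) := by
    rw [cos_add, cos_sub]; ring
  have abs_cos_A : |2 * cos A| = 2 * cos A := abs_of_pos (by linarith)
  have abs_cos_B : |2 * cos B| = 2 * cos B := abs_of_pos (by linarith)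
  ext i j
  fin_cases i <;> fin_cases j <;>
    simp [mutateMatrix, stateMatrix, abs_cos_A, abs_cos_B, cos_sub_eq] <;>
    ring

theorem neg_state_up_v_two : -(F.state A (A + B) p).v 2 = (F.state A B p).v 1 := by
  have angle_eq : π + (A + B - A) + π = B + 2 * π := by ring
  rw [state_v_two, state_v_one, neg_vec, angle_eq, vec_add_two_pi, add_sub_cancel_left]
  exact F.vec_congr rfl rfl (by ring)

theorem state_up_v_one_sub_form (hA : sin A ≠ 0) :
    (F.state A (A + B) p).v 1 - form ((F.state A (A + B) p).v 1) ((F.state A (A + B) p).v 2) •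
      (F.state A (A + B) p).v 2 = (F.state A B p).v 2 := by
  have angle_eq : 2 * (π + (A + B - A)) - (A + B) + π = π + (B - A) + 2 * π := by ring
  rw [state_v_two, state_v_one, state_v_two, vec_sub_form, angle_eq, vec_add_two_pi]
  refine F.vec_congr rfl rfl ?_
  rw [show A + B - (π + (A + B - A)) = A - π by ring, cos_sub_pi, add_sub_cancel_left,
    cos_add A (A + B), sin_sub, sin_add, cos_add]
  field_simp
  linear_combination -F.K * cos B * sin_sq_add_cos_sq A

theorem mutate_two_state_up (hA : 0 < A) (hB : 0 ≤ B) (hAB : A + B < π / 2) :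
    (F.state A (A + B) p).mutate T 2 = (F.state A B p).permute (Equiv.swap 1 2) := by
  have hcA : 0 < cos A := cos_pos_of_mem_Ioo ⟨by linarith, by linarith⟩
  have hcAB : 0 < cos (A + B) := cos_pos_of_mem_Ioo ⟨by linarith, hAB⟩
  have hsA : 0 < sin A := sin_pos_of_pos_of_lt_pi hA (by linarith)
  have hpos : IsPositive T ((F.state A (A + B) p).v 2) :=
    (F.isPositive_state_v_two_iff p hA (by linarith) (by linarith) hAB).2 (by linarith)
  have arrow : 0 < (F.state A (A + B) p).B 0 2 := show 0 < 2 * cos (A + B) by linarith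
  have no_arrow : ¬ 0 < (F.state A (A + B) p).B 1 2 := show ¬ 0 < -(2 * cos A) by linarith
  refine LabelledSeed.ext (funext fun i => ?_) ?_
  · match i with
    | 0 =>
      rw [LabelledSeed.mutate_v_of_isPositive hpos (by decide), if_pos arrow]
      rfl
    | 1 =>
      rw [LabelledSeed.mutate_v_of_isPositive hpos (by decide), if_neg no_arrow]
      exact F.state_up_v_one_sub_form p hsA.ne'
    | 2 => exact (LabelledSeed.mutate_v_self _ 2).trans (F.neg_state_up_v_two p)
  · refine (mutateMatrix_stateMatrix_two hcA hcAB).trans ?_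
    ext i j
    fin_cases i <;> fin_cases j <;>
      simp [LabelledSeed.permute, state, stateMatrix, Equiv.swap_apply_def]

end Up

section Right

variable {A B : ℝ} (p : ℝ)

theorem neg_state_right_v_two (hA : sin A ≠ 0) (hAB : sin (A + B) ≠ 0) :
    -(F.state (A + B) B (p - F.K * displacement A B)).v 2 = (F.state A B p).v 0 := by
  have angle_eq : π + (B - (A + B)) + π = -A + 2 * π := by ring
  rw [state_v_two, state_v_zero, neg_vec, angle_eq, vec_add_two_pi,
    show B - (A + B) = -A by ring, sin_neg, displacement]
  refine F.vec_congr rfl rfl ?_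
  field_simp
  ring

theorem state_right_v_one (hA : sin A ≠ 0) (hAB : sin (A + B) ≠ 0) :
    (F.state (A + B) B (p - F.K * displacement A B)).v 1 = (F.state A B p).v 1 := by
  rw [state_v_one, state_v_one, displacement]
  refine F.vec_congr rfl rfl ?_
  have trig : sin B * cos B + cos (A + B + B) * sin A = cos (A + B) * sin (A + B) := by
    have sin_A : sin A = sin (A + B) * cos B - cos (A + B) * sin B := by
      rw [← sin_sub, add_sub_cancel_right]
    rw [cos_add (A + B) B, sin_A]
    linear_combination (sin (A + B) * cos (A + B)) * sin_sq_add_cos_sq B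
      - sin B * cos B * sin_sq_add_cos_sq (A + B)
  field_simp
  linear_combination F.K * trig

theorem state_right_v_zero_sub_form (hA : sin A ≠ 0) (hAB : sin (A + B) ≠ 0) :
    (F.state (A + B) B (p - F.K * displacement A B)).v 0 -
        form ((F.state (A + B) B (p - F.K * displacement A B)).v 0)
          ((F.state (A + B) B (p - F.K * displacement A B)).v 2) •
        (F.state (A + B) B (p - F.K * displacement A B)).v 2 = (F.state A B p).v 2 := by
  have angle_eq : 2 * (π + (B - (A + B))) - -(A + B) + π = π + (B - A) + 2 * π := by ring
  rw [state_v_zero, state_v_two, state_v_two, vec_sub_form, angle_eq, vec_add_two_pi,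
    displacement]
  refine F.vec_congr rfl rfl ?_
  rw [show -(A + B) - (π + (B - (A + B))) = -(B + π) by ring, cos_neg, cos_add_pi,
    show B - (A + B) = -A by ring, sin_neg]
  have sin_sub_eq : sin (B - A) = sin (A + B) - 2 * cos B * sin A := by
    rw [sin_sub, sin_add]; ring
  rw [sin_sub_eq]
  field_simp
  ring

theorem mutate_two_state_right (hA : 0 < A) (hB : 0 ≤ B) (hAB : A + B < π / 2) :
    (F.state (A + B) B (p - F.K * displacement A B)).mutate T 2 =
      (F.state A B p).permute (Equiv.swap 0 2) := by
  set s := F.state (A + B) B (p - F.K * displacement A B) with hs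
  have hcB : 0 < cos B := cos_pos_of_mem_Ioo ⟨by linarith, by linarith⟩
  have hcAB : 0 < cos (A + B) := cos_pos_of_mem_Ioo ⟨by linarith, hAB⟩
  have hsA : sin A ≠ 0 := (sin_pos_of_pos_of_lt_pi hA (by linarith)).ne'
  have hsAB : sin (A + B) ≠ 0 := (sin_pos_of_pos_of_lt_pi (by linarith) (by linarith)).ne'
  have hneg : ¬ IsPositive T (s.v 2) := by
    rw [hs, F.isPositive_state_v_two_iff _ (by linarith) hAB hB (by linarith)]
    linarith
  have arrow : s.B 1 2 < 0 := show -(2 * cos (A + B)) < 0 by linarith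
  have no_arrow : ¬ s.B 0 2 < 0 := show ¬ 2 * cos B < 0 by linarith
  refine LabelledSeed.ext (funext fun i => ?_) ?_
  · match i with
    | 0 =>
      rw [LabelledSeed.mutate_v_of_not_isPositive hneg (by decide), if_neg no_arrow]
      exact F.state_right_v_zero_sub_form p hsA hsAB
    | 1 =>
      rw [LabelledSeed.mutate_v_of_not_isPositive hneg (by decide), if_pos arrow]
      exact F.state_right_v_one p hsA hsAB
    | 2 => exact (LabelledSeed.mutate_v_self _ 2).trans (F.neg_state_right_v_two p hsA hsAB)
  · refine (mutateMatrix_stateMatrix_two hcAB hcB).trans ?_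
    ext i j
    fin_cases i <;> fin_cases j <;>
      simp [LabelledSeed.permute, state, stateMatrix, Equiv.swap_apply_def]

end Right

section Turn

variable {A B : ℝ} (p : ℝ)

theorem flip_state_turn_v_one (hA : sin A ≠ 0) (hAB : sin (A + B) ≠ 0) :
    (F.flip.state (π - (A + B)) A (p - F.K * displacement A B)).v 1 = -(F.state A B p).v 0 := by
  rw [state_v_one, state_v_zero, flip_vec, neg_vec, show F.flip.K = F.K from rfl, sin_pi_sub,
    show π - (A + B) + A = π - B by ring, cos_pi_sub, show -A + π = π - A by ring, displacement]
  refine F.vec_congr rfl rfl ?_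
  field_simp
  ring

theorem flip_state_turn_v_zero (hA : sin A ≠ 0) (hAB : sin (A + B) ≠ 0) :
    (F.flip.state (π - (A + B)) A (p - F.K * displacement A B)).v 0 =
      (F.state A B p).v 2 -
        form ((F.state A B p).v 2) ((F.state A B p).v 0) • (F.state A B p).v 0 := by
  have angle_eq : π - -(π - (A + B)) = 2 * -A - (π + (B - A)) + π + 2 * π := by ring
  rw [state_v_zero, state_v_zero, state_v_two, flip_vec, vec_sub_form, angle_eq, vec_add_two_pi,
    sin_pi_sub, displacement, show π + (B - A) - -A = B + π by ring, cos_add_pi]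
  refine F.vec_congr rfl rfl ?_
  have sin_sub_eq : sin (B - A) = sin (A + B) - 2 * cos B * sin A := by
    rw [sin_sub, sin_add]; ring
  rw [sin_sub_eq]
  field_simp
  ring

theorem flip_state_turn_v_two (hA : sin A ≠ 0) (hAB : sin (A + B) ≠ 0) :
    (F.flip.state (π - (A + B)) A (p - F.K * displacement A B)).v 2 =
      (F.state A B p).v 1 -
        form ((F.state A B p).v 1) ((F.state A B p).v 0) • (F.state A B p).v 0 := by
  have angle_eq : π - (π + (A - (π - (A + B)))) = 2 * -A - B + π := by ring
  rw [state_v_zero, state_v_one, state_v_two, flip_vec, vec_sub_form, angle_eq,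
    show F.flip.K = F.K from rfl, sin_pi_sub, show B - -A = A + B by ring,
    show A - (π - (A + B)) = A + (A + B) - π by ring, sin_sub_pi, displacement]
  refine F.vec_congr rfl rfl ?_
  have sin_B : sin B = sin (A + B) * cos A - cos (A + B) * sin A := by
    rw [← sin_sub, add_sub_cancel_left]
  have cos_B : cos B = cos (A + B) * cos A + sin (A + B) * sin A := by
    rw [← cos_sub, add_sub_cancel_left]
  rw [sin_add A (A + B), sin_B, cos_B]
  field_simp
  linear_combination F.K * (sin A * cos A * sin_sq_add_cos_sq (A + B)
    + sin (A + B) * cos (A + B) * sin_sq_add_cos_sq A)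

theorem mutate_zero_state_turn (hA : A < π / 2) (hB : B < π / 2) (hAB : π / 2 < A + B) :
    (F.state A B p).mutate T 0 =
      (F.flip.state (π - (A + B)) A (p - F.K * displacement A B)).permute
        (Equiv.swap 0 2 * Equiv.swap 0 1) := by
  have hsA : 0 < sin A := sin_pos_of_pos_of_lt_pi (by linarith) (by linarith)
  have hsAB : sin (A + B) ≠ 0 := (sin_pos_of_pos_of_lt_pi (by linarith) (by linarith)).ne'
  have hcB : 0 < cos B := cos_pos_of_mem_Ioo ⟨by linarith, by linarith⟩
  have hcAB : cos (A + B) < 0 := cos_neg_of_pi_div_two_lt_of_lt hAB (by linarith)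
  have hpos := F.isPositive_state_v_zero p (B := B) hsA
  have no_arrow_one : ¬ 0 < (F.state A B p).B 1 0 := show ¬ 0 < 2 * cos (A + B) by linarith
  have no_arrow_two : ¬ 0 < (F.state A B p).B 2 0 := show ¬ 0 < -(2 * cos B) by linarith
  refine LabelledSeed.ext (funext fun i => ?_) ?_
  · match i with
    | 0 =>
      rw [LabelledSeed.mutate_v_self]
      exact (F.flip_state_turn_v_one p hsA.ne' hsAB).symm
    | 1 =>
      rw [LabelledSeed.mutate_v_of_isPositive hpos (by decide), if_neg no_arrow_one]
      exact (F.flip_state_turn_v_two p hsA.ne' hsAB).symm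
    | 2 =>
      rw [LabelledSeed.mutate_v_of_isPositive hpos (by decide), if_neg no_arrow_two]
      exact (F.flip_state_turn_v_zero p hsA.ne' hsAB).symm
  · have abs_cos_B : |2 * cos B| = 2 * cos B := abs_of_pos (by linarith)
    have abs_cos_AB : |2 * cos (A + B)| = -(2 * cos (A + B)) := abs_of_neg (by linarith)
    have cos_eq : cos (π - (A + B) + A) = -cos B := by
      rw [show π - (A + B) + A = π - B by ring, cos_pi_sub]
    ext i j
    fin_cases i <;> fin_cases j <;>
      simp [LabelledSeed.mutate, LabelledSeed.permute, state, stateMatrix, mutateMatrix, abs_cos_B,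
        abs_cos_AB, cos_eq, Equiv.swap_apply_def]

end Turn

end BeltFrame

section UnitAngle

/-- The angle at the apex of the initial triangle; all angles between the lines of a seed are
multiples of it. -/
def unitAngle (n : ℕ) : ℝ := π / (2 * n + 1)

variable (n : ℕ)

theorem unitAngle_pos : 0 < unitAngle n := by
  unfold unitAngle
  positivity

theorem two_mul_add_one_mul_unitAngle : (2 * n + 1) * unitAngle n = π := by
  unfold unitAngle
  field_simp

variable {n} {a : ℕ}

theorem mul_unitAngle_lt (h : a ≤ n) : a * unitAngle n < π / 2 := by
  have a_le : a * unitAngle n ≤ n * unitAngle n :=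
    mul_le_mul_of_nonneg_right (Nat.cast_le.2 h) (unitAngle_pos n).le
  linarith [two_mul_add_one_mul_unitAngle n, unitAngle_pos n]

theorem lt_mul_unitAngle (h : n < a) : π / 2 < a * unitAngle n := by
  have le_a : (n + 1 : ℝ) * unitAngle n ≤ a * unitAngle n :=
    mul_le_mul_of_nonneg_right (by exact_mod_cast h) (unitAngle_pos n).le
  linarith [two_mul_add_one_mul_unitAngle n, unitAngle_pos n]

theorem sub_mul_unitAngle (h : a ≤ 2 * n + 1) :
    ((2 * n + 1 - a : ℕ) : ℝ) * unitAngle n = π - a * unitAngle n := by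
  rw [Nat.cast_sub h, ← two_mul_add_one_mul_unitAngle n]
  push_cast
  ring

theorem mul_unitAngle_pos (h : 1 ≤ a) : 0 < a * unitAngle n :=
  mul_pos (Nat.cast_pos.2 h) (unitAngle_pos n)

theorem mul_unitAngle_nonneg (n a : ℕ) : 0 ≤ a * unitAngle n :=
  mul_nonneg a.cast_nonneg (unitAngle_pos n).le

end UnitAngle

/-- Combinatorial data of a seed: an orientation of the plane, two angles as multiples of the unit
angle, and a position on the belt line. -/
@[ext]
structure SeedParam where
  /-- whether the seed is read in the given frame or in its mirror image -/
  ε : Bool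
  /-- the first angle -/
  a : ℕ
  /-- the second angle -/
  b : ℕ
  /-- the position on the belt line -/
  p : ℝ

/-- The change of position, in units of length, under a mutation that moves the first line. -/
def increment (n a b : ℕ) : ℝ := BeltFrame.displacement (a * unitAngle n) (b * unitAngle n)

/-- `Move n K i j s t` says that mutation at `i` turns a seed with parameters `s` into one with
parameters `t` and that mutation at `j` turns it back; each mutation occurs in one of the two
directions. -/
inductive Move (n : ℕ) (K : ℝ) : Fin 3 → Fin 3 → SeedParam → SeedParam → Prop
  | up (ε : Bool) (a b : ℕ) (p : ℝ) : 1 ≤ a → a + b ≤ n →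
      Move n K 1 2 ⟨ε, a, b, p⟩ ⟨ε, a, a + b, p⟩
  | right (ε : Bool) (a b : ℕ) (p : ℝ) : 1 ≤ a → a + b ≤ n →
      Move n K 0 2 ⟨ε, a, b, p⟩ ⟨ε, a + b, b, p - K * increment n a b⟩
  | turn (ε : Bool) (a b : ℕ) (p : ℝ) : a ≤ n → b ≤ n → n < a + b →
      Move n K 0 1 ⟨ε, a, b, p⟩ ⟨!ε, 2 * n + 1 - (a + b), a, p - K * increment n a b⟩

/-- The mutations in terms of the parameters. -/
def Step (n : ℕ) (K : ℝ) (s t : SeedParam) : Prop :=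
  ∃ i j, Move n K i j s t ∨ Move n K j i t s

/-- The two angles are admissible: multiples of the unit angle below `π / 2`, the first one
positive. -/
def SeedParam.Valid (n : ℕ) (s : SeedParam) : Prop := 1 ≤ s.a ∧ s.a ≤ n ∧ s.b ≤ n

/-- The parameters of the initial seed. -/
def initialParam (n : ℕ) : SeedParam := ⟨true, 1, n, 0⟩

theorem initialParam_valid {n : ℕ} (hn : 1 ≤ n) : (initialParam n).Valid n :=
  ⟨le_rfl, hn, le_rfl⟩

section Moves

variable {n : ℕ} {K : ℝ} {s t : SeedParam} {i j : Fin 3}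

instance : Std.Symm (Step n K) := ⟨fun _ _ ⟨i, j, h⟩ => ⟨j, i, h.symm⟩⟩

theorem Move.step (h : Move n K i j s t) : Step n K s t := ⟨i, j, Or.inl h⟩

theorem Move.valid (h : Move n K i j s t) : s.Valid n ∧ t.Valid n := by
  cases h <;> simp only [SeedParam.Valid] <;> omega

theorem Step.valid (h : Step n K s t) : t.Valid n :=
  let ⟨_, _, h⟩ := h
  h.elim (fun h => h.valid.2) fun h => h.valid.1

theorem Move.right_to (ε : Bool) {a b : ℕ} (p : ℝ) (ha : 1 ≤ a) (hab : a + b ≤ n) :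
    Move n K 0 2 ⟨ε, a, b, p + K * increment n a b⟩ ⟨ε, a + b, b, p⟩ := by
  simpa only [add_sub_cancel_right] using Move.right (K := K) ε a b (p + K * increment n a b) ha hab

theorem Move.turn_to (ε : Bool) {a b : ℕ} (p : ℝ) (ha : a ≤ n) (hb : b ≤ n) (hab : n < a + b) :
    Move n K 0 1 ⟨ε, a, b, p + K * increment n a b⟩ ⟨!ε, 2 * n + 1 - (a + b), a, p⟩ := by
  simpa only [add_sub_cancel_right] using
    Move.turn (K := K) ε a b (p + K * increment n a b) ha hb hab

theorem exists_move_of_valid (hs : s.Valid n) (i : Fin 3) :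
    ∃ t j, Move n K i j s t ∨ Move n K j i t s := by
  obtain ⟨ε, a, b, p⟩ := s
  obtain ⟨ha, han, hbn⟩ : 1 ≤ a ∧ a ≤ n ∧ b ≤ n := hs
  match i with
  | 0 =>
    rcases le_or_gt (a + b) n with hab | hab
    · exact ⟨_, _, Or.inl (.right ε a b p ha hab)⟩
    · exact ⟨_, _, Or.inl (.turn ε a b p han hbn hab)⟩
  | 1 =>
    rcases le_or_gt (a + b) n with hab | hab
    · exact ⟨_, _, Or.inl (.up ε a b p ha hab)⟩
    · have move := Move.turn_to (K := K) (!ε) (a := b) (b := 2 * n + 1 - (a + b)) p hbn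
        (by omega) (by omega)
      rw [show 2 * n + 1 - (b + (2 * n + 1 - (a + b))) = a by omega, Bool.not_not] at move
      exact ⟨_, _, Or.inr move⟩
  | 2 =>
    rcases le_or_gt a b with hab | hab
    · obtain ⟨c, rfl⟩ := Nat.exists_eq_add_of_le hab
      exact ⟨_, _, Or.inr (.up ε a c p ha hbn)⟩
    · obtain ⟨c, rfl⟩ := Nat.exists_eq_add_of_le' hab.le
      exact ⟨_, _, Or.inr (.right_to ε p (by omega) han)⟩

end Moves

namespace BeltFrame

variable (F : BeltFrame T) {n : ℕ}

/-- The frame or its mirror image. -/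
def orient : Bool → BeltFrame T
  | true => F
  | false => F.flip

theorem orient_not (ε : Bool) : F.orient (!ε) = (F.orient ε).flip := by
  cases ε
  · exact F.flip_flip.symm
  · rfl

theorem orient_K (ε : Bool) : (F.orient ε).K = F.K := by cases ε <;> rfl

theorem orient_e (ε : Bool) : (F.orient ε).e = F.e := by cases ε <;> rfl

/-- The labelled seed with given parameters. -/
def labelledSeedOf (n : ℕ) (s : SeedParam) : LabelledSeed :=
  (F.orient s.ε).state (s.a * unitAngle n) (s.b * unitAngle n) s.p

/-- The seed with given parameters. -/
def seedOf (n : ℕ) (s : SeedParam) : Seed := Quotient.mk _ (F.labelledSeedOf n s)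

theorem mutate_labelledSeedOf_up {a b : ℕ} (ε : Bool) (p : ℝ) (ha : 1 ≤ a) (hab : a + b ≤ n) :
    (F.labelledSeedOf n ⟨ε, a, a + b, p⟩).mutate T 2 =
      (F.labelledSeedOf n ⟨ε, a, b, p⟩).permute (Equiv.swap 1 2) := by
  have sum_lt := mul_unitAngle_lt hab
  simp only [labelledSeedOf, Nat.cast_add, add_mul] at sum_lt ⊢
  exact (F.orient ε).mutate_two_state_up p (mul_unitAngle_pos ha) (mul_unitAngle_nonneg n b) sum_lt

theorem mutate_labelledSeedOf_right {a b : ℕ} (ε : Bool) (p : ℝ) (ha : 1 ≤ a) (hab : a + b ≤ n) :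
    (F.labelledSeedOf n ⟨ε, a + b, b, p - F.K * increment n a b⟩).mutate T 2 =
      (F.labelledSeedOf n ⟨ε, a, b, p⟩).permute (Equiv.swap 0 2) := by
  have sum_lt := mul_unitAngle_lt hab
  simp only [labelledSeedOf, Nat.cast_add, add_mul, ← F.orient_K ε] at sum_lt ⊢
  exact (F.orient ε).mutate_two_state_right p (mul_unitAngle_pos ha) (mul_unitAngle_nonneg n b)
    sum_lt

theorem mutate_labelledSeedOf_turn {a b : ℕ} (ε : Bool) (p : ℝ) (ha : a ≤ n) (hb : b ≤ n)
    (hab : n < a + b) :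
    (F.labelledSeedOf n ⟨ε, a, b, p⟩).mutate T 0 =
      (F.labelledSeedOf n ⟨!ε, 2 * n + 1 - (a + b), a, p - F.K * increment n a b⟩).permute
        (Equiv.swap 0 2 * Equiv.swap 0 1) := by
  have lt_sum := lt_mul_unitAngle hab
  simp only [labelledSeedOf, sub_mul_unitAngle (show a + b ≤ 2 * n + 1 by omega), orient_not,
    Nat.cast_add, add_mul, ← F.orient_K ε] at lt_sum ⊢
  exact (F.orient ε).mutate_zero_state_turn p (mul_unitAngle_lt ha) (mul_unitAngle_lt hb) lt_sum

theorem isPositive_neg_labelledSeedOf_zero {s : SeedParam} (hs : s.Valid n) :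
    IsPositive T (-(F.labelledSeedOf n s).v 0) ↔ ¬ IsPositive T ((F.labelledSeedOf n s).v 0) :=
  (F.orient s.ε).isPositive_neg_state_v_zero s.p <| ne_of_gt <|
    sin_pos_of_pos_of_lt_pi (mul_unitAngle_pos hs.1)
      ((mul_unitAngle_lt hs.2.1).trans (half_lt_self pi_pos))

theorem isPositive_neg_labelledSeedOf_two {s : SeedParam} (hs : s.Valid n) :
    IsPositive T (-(F.labelledSeedOf n s).v 2) ↔ ¬ IsPositive T ((F.labelledSeedOf n s).v 2) :=
  (F.orient s.ε).isPositive_neg_state_v_two s.p (mul_unitAngle_pos hs.1) (mul_unitAngle_lt hs.2.1)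
    (mul_unitAngle_nonneg n s.b) (mul_unitAngle_lt hs.2.2)

theorem mk_mutate_of_move {s t : SeedParam} {i j : Fin 3} (h : Move n F.K i j s t) :
    Quotient.mk _ ((F.labelledSeedOf n s).mutate T i) = F.seedOf n t ∧
      Quotient.mk _ ((F.labelledSeedOf n t).mutate T j) = F.seedOf n s := by
  obtain ⟨hs, ht⟩ := h.valid
  have form_v_self : ∀ s i, form ((F.labelledSeedOf n s).v i) ((F.labelledSeedOf n s).v i) = 2 :=
    fun s => (F.orient s.ε).form_state_v_self _ _ _
  cases h with
  | up ε a b p ha hab =>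
    exact (mk_mutate_of_eq_permute (form_v_self _ _) (F.isPositive_neg_labelledSeedOf_two ht)
      (F.mutate_labelledSeedOf_up ε p ha hab)).symm
  | right ε a b p ha hab =>
    exact (mk_mutate_of_eq_permute (form_v_self _ _) (F.isPositive_neg_labelledSeedOf_two ht)
      (F.mutate_labelledSeedOf_right ε p ha hab)).symm
  | turn ε a b p ha hb hab =>
    exact mk_mutate_of_eq_permute (form_v_self _ _) (F.isPositive_neg_labelledSeedOf_zero hs)
      (F.mutate_labelledSeedOf_turn ε p ha hb hab)

theorem isMutation_seedOf_iff {s : SeedParam} (hs : s.Valid n) (y : Seed) :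
    IsMutation T (F.seedOf n s) y ↔ ∃ t, Step n F.K s t ∧ y = F.seedOf n t := by
  constructor
  · intro h
    obtain ⟨i, rfl⟩ := (isMutation_mk_iff _ _).1 h
    obtain ⟨t, j, move⟩ := exists_move_of_valid (K := F.K) hs i
    exact ⟨t, ⟨i, j, move⟩, move.elim (fun h => (F.mk_mutate_of_move h).1)
      fun h => (F.mk_mutate_of_move h).2⟩
  · rintro ⟨t, ⟨i, j, move⟩, rfl⟩
    exact (isMutation_mk_iff _ _).2 ⟨i, move.elim (fun h => (F.mk_mutate_of_move h).1.symm)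
      fun h => (F.mk_mutate_of_move h).2.symm⟩

theorem reflTransGen_isMutation_iff {s : SeedParam} (hs : s.Valid n) (y : Seed) :
    Relation.ReflTransGen (IsMutation T) (F.seedOf n s) y ↔
      ∃ t, t.Valid n ∧ Relation.ReflTransGen (Step n F.K) s t ∧ y = F.seedOf n t := by
  constructor
  · intro h
    induction h with
    | refl => exact ⟨s, hs, .refl, rfl⟩
    | tail _ hyz ih =>
      obtain ⟨t, ht, hst, rfl⟩ := ih
      obtain ⟨u, htu, rfl⟩ := (F.isMutation_seedOf_iff ht _).1 hyz
      exact ⟨u, htu.valid, hst.tail htu, rfl⟩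
  · rintro ⟨t, -, hst, rfl⟩
    exact hst.lift (F.seedOf n) fun u v huv =>
      (F.isMutation_seedOf_iff (symm huv).valid _).2 ⟨v, huv, rfl⟩

end BeltFrame

/-- Translation along the belt line, in terms of the parameters. -/
def SeedParam.shift (u : ℝ) (s : SeedParam) : SeedParam := { s with p := s.p + u }

theorem SeedParam.shift_zero (s : SeedParam) : s.shift 0 = s :=
  SeedParam.ext rfl rfl rfl (add_zero s.p)

theorem SeedParam.shift_shift (u v : ℝ) (s : SeedParam) : (s.shift v).shift u = s.shift (u + v) :=
  SeedParam.ext rfl rfl rfl (by simp only [shift]; ring)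

section Shift

variable {n : ℕ} {K : ℝ} {s t : SeedParam} {i j : Fin 3} (u : ℝ)

theorem Move.shift (h : Move n K i j s t) : Move n K i j (s.shift u) (t.shift u) := by
  cases h with
  | up ε a b p ha hab => exact .up ε a b (p + u) ha hab
  | right ε a b p ha hab =>
    simpa only [SeedParam.shift, sub_add_eq_add_sub] using Move.right (K := K) ε a b (p + u) ha hab
  | turn ε a b p ha hb hab =>
    simpa only [SeedParam.shift, sub_add_eq_add_sub] using
      Move.turn (K := K) ε a b (p + u) ha hb hab

theorem Step.shift (h : Step n K s t) : Step n K (s.shift u) (t.shift u) :=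
  let ⟨i, j, h⟩ := h
  ⟨i, j, h.imp (Move.shift u) (Move.shift u)⟩

theorem reflTransGen_step_shift (h : Relation.ReflTransGen (Step n K) s t) :
    Relation.ReflTransGen (Step n K) (s.shift u) (t.shift u) :=
  h.lift (SeedParam.shift u) fun _ _ => Step.shift u

end Shift

namespace SeedParam

/-- The angles of the normals of the three lines of a seed, as multiples of the unit angle. -/
def direction (n : ℕ) (s : SeedParam) : Fin 3 → ℤ :=
  match s.ε with
  | true => ![-s.a, s.b, 2 * n + 1 + (s.b - s.a)]
  | false => ![2 * n + 1 + s.a, 2 * n + 1 - s.b, s.a - s.b]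

variable {n : ℕ} {s t : SeedParam}

theorem neg_le_direction (hs : s.Valid n) (i : Fin 3) : -n ≤ s.direction n i := by
  obtain ⟨ε, a, b, p⟩ := s
  obtain ⟨ha, han, hbn⟩ : 1 ≤ a ∧ a ≤ n ∧ b ≤ n := hs
  cases ε <;> fin_cases i <;> simp [direction] <;> omega

theorem direction_le (hs : s.Valid n) (i : Fin 3) : s.direction n i ≤ 3 * n + 1 := by
  obtain ⟨ε, a, b, p⟩ := s
  obtain ⟨ha, han, hbn⟩ : 1 ≤ a ∧ a ≤ n ∧ b ≤ n := hs
  cases ε <;> fin_cases i <;> simp [direction] <;> omega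

theorem direction_eq_of_dvd (hs : s.Valid n) (ht : t.Valid n) {i j : Fin 3}
    (h : 2 * (2 * n + 1 : ℤ) ∣ t.direction n i - s.direction n j) :
    t.direction n i = s.direction n j := by
  refine sub_eq_zero.1 (Int.eq_zero_of_abs_lt_dvd h (abs_lt.2 ⟨?_, ?_⟩)) <;>
    linarith [neg_le_direction hs j, direction_le hs j, neg_le_direction ht i, direction_le ht i]

theorem eq_of_direction_eq_comp_perm (hs : s.Valid n) (ht : t.Valid n) {σ : Equiv.Perm (Fin 3)}
    (h : ∀ i, t.direction n i = s.direction n (σ i)) :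
    (s.ε = t.ε ∧ s.a = t.a ∧ s.b = t.b) ∧ σ 0 = 0 ∧ σ 1 = 1 := by
  have σ₀₁ : σ 0 ≠ σ 1 := σ.injective.ne (by decide)
  have σ₀₂ : σ 0 ≠ σ 2 := σ.injective.ne (by decide)
  have σ₁₂ : σ 1 ≠ σ 2 := σ.injective.ne (by decide)
  have h₀ := h 0
  have h₁ := h 1
  have h₂ := h 2
  obtain ⟨ε, a, b, p⟩ := s
  obtain ⟨ε', a', b', p'⟩ := t
  obtain ⟨ha, han, hbn⟩ : 1 ≤ a ∧ a ≤ n ∧ b ≤ n := hs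
  obtain ⟨ha', han', hbn'⟩ : 1 ≤ a' ∧ a' ≤ n ∧ b' ≤ n := ht
  generalize σ 0 = i₀ at *
  generalize σ 1 = i₁ at *
  generalize σ 2 = i₂ at *
  cases ε <;> cases ε' <;> fin_cases i₀ <;> fin_cases i₁ <;> fin_cases i₂ <;>
    simp [direction] at h₀ h₁ h₂ σ₀₁ σ₀₂ σ₁₂ ⊢ <;> omega

end SeedParam

namespace BeltFrame

variable (F : BeltFrame T) {n : ℕ}

theorem translate_labelledSeedOf (n : ℕ) (u : ℝ) (s : SeedParam) :
    (F.labelledSeedOf n s).translate (u • F.e) = F.labelledSeedOf n (s.shift u) := by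
  rw [labelledSeedOf, ← F.orient_e s.ε, translate_state]
  rfl

theorem translate_seedOf (n : ℕ) (u : ℝ) (s : SeedParam) :
    translate (u • F.e) (F.seedOf n s) = F.seedOf n (s.shift u) :=
  congrArg (Quotient.mk _) (F.translate_labelledSeedOf n u s)

theorem labelledSeedOf_v_fst (n : ℕ) (s : SeedParam) (i : Fin 3) :
    ((F.labelledSeedOf n s).v i).1 = F.normal (s.direction n i * unitAngle n) := by
  have state_v_fst : ∀ (G : BeltFrame T) A B p, ((G.state A B p).v i).1 =
      G.normal (![-A, B, π + (B - A)] i) := by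
    intro G A B p
    fin_cases i <;> rfl
  have pi_eq := two_mul_add_one_mul_unitAngle n
  obtain ⟨ε, a, b, p⟩ := s
  rw [labelledSeedOf, state_v_fst]
  cases ε
  · refine (F.flip_normal _).trans (congrArg F.normal ?_)
    fin_cases i <;> simp [SeedParam.direction, ← pi_eq] <;> ring
  · refine congrArg F.normal ?_
    fin_cases i <;> simp [SeedParam.direction, ← pi_eq]
    ring

theorem dvd_of_normal_eq {k l : ℤ}
    (h : F.normal (k * unitAngle n) = F.normal (l * unitAngle n)) :
    2 * (2 * n + 1 : ℤ) ∣ k - l := by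
  have sqrt_two_ne : √2 ≠ 0 := sqrt_ne_zero'.2 zero_lt_two
  have sin_eq : sin (k * unitAngle n) = sin (l * unitAngle n) :=
    mul_left_cancel₀ sqrt_two_ne (by rw [← inner_normal_e, h, inner_normal_e])
  have cos_eq : cos (k * unitAngle n) = cos (l * unitAngle n) :=
    mul_left_cancel₀ sqrt_two_ne
      (neg_injective (by rw [← inner_normal_f, h, inner_normal_f]))
  obtain ⟨m, hm⟩ := Real.Angle.angle_eq_iff_two_pi_dvd_sub.1 (Real.Angle.cos_sin_inj cos_eq sin_eq)
  refine ⟨m, ?_⟩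
  have sub_eq : (k : ℝ) - l = 2 * (2 * n + 1) * m := by
    refine mul_right_cancel₀ (unitAngle_pos n).ne' ?_
    rw [← two_mul_add_one_mul_unitAngle n] at hm
    linear_combination hm
  exact_mod_cast sub_eq

theorem eq_of_inner_eq {x y : Plane} (he : inner ℝ F.e x = (inner ℝ F.e y : ℝ))
    (hf : inner ℝ F.f x = (inner ℝ F.f y : ℝ)) : x = y := by
  have orthonormal : Orthonormal ℝ ![F.e, F.f] := by
    rw [orthonormal_iff_ite]
    intro i j
    fin_cases i <;> fin_cases j
    exacts [F.inner_e_e, F.inner_e_f, (real_inner_comm _ _).trans F.inner_e_f, F.inner_f_f]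
  refine InnerProductSpace.ext_inner_left_basis (𝕜 := ℝ)
    (basisOfOrthonormalOfCardEqFinrank orthonormal (by simp)) fun i => ?_
  rw [coe_basisOfOrthonormalOfCardEqFinrank]
  fin_cases i
  exacts [he, hf]

theorem eq_of_inner_normal_eq {A B : ℝ} (hAB : sin (A + B) ≠ 0) {x y : Plane}
    (hA : inner ℝ (F.normal (-A)) x = (inner ℝ (F.normal (-A)) y : ℝ))
    (hB : inner ℝ (F.normal B) x = (inner ℝ (F.normal B) y : ℝ)) : x = y := by
  have sqrt_two_ne : √2 ≠ 0 := sqrt_ne_zero'.2 zero_lt_two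
  simp only [normal, real_inner_smul_left, inner_sub_left, sin_neg, cos_neg,
    mul_right_inj' sqrt_two_ne] at hA hB
  rw [sin_add] at hAB
  refine F.eq_of_inner_eq (mul_left_cancel₀ hAB ?_) (mul_left_cancel₀ hAB ?_)
  · linear_combination -cos B * hA + cos A * hB
  · linear_combination -sin B * hA - sin A * hB

theorem seedOf_eq_translate {s t : SeedParam} (hs : s.Valid n) (ht : t.Valid n) {w : Plane}
    (h : F.seedOf n s = translate w (F.seedOf n t)) :
    s = t.shift (s.p - t.p) ∧ w = (s.p - t.p) • F.e := by
  obtain ⟨σ, hσ, -⟩ := Quotient.exact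
    (h : Quotient.mk _ _ = Quotient.mk _ ((F.labelledSeedOf n t).translate w))
  have direction_eq : ∀ i, t.direction n i = s.direction n (σ i) := fun i =>
    SeedParam.direction_eq_of_dvd hs ht <| F.dvd_of_normal_eq <| by
      rw [← labelledSeedOf_v_fst, ← labelledSeedOf_v_fst, ← hσ i]
      rfl
  obtain ⟨⟨hε, ha, hb⟩, hσ₀, hσ₁⟩ := SeedParam.eq_of_direction_eq_comp_perm hs ht direction_eq
  have s_eq : s = t.shift (s.p - t.p) :=
    SeedParam.ext hε ha hb (add_sub_cancel t.p s.p).symm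
  refine ⟨s_eq, ?_⟩
  have inner_eq : ∀ i, σ i = i → inner ℝ ((F.labelledSeedOf n t).v i).1 w =
      (inner ℝ ((F.labelledSeedOf n t).v i).1 ((s.p - t.p) • F.e) : ℝ) := by
    intro i hi
    have v_eq := hσ i
    rw [hi, s_eq, ← translate_labelledSeedOf] at v_eq
    exact sub_right_injective (congrArg Prod.snd v_eq)
  refine (F.orient t.ε).eq_of_inner_normal_eq (ne_of_gt (sin_pos_of_pos_of_lt_pi ?_ ?_))
    (inner_eq 0 hσ₀) (inner_eq 1 hσ₁)
  · exact add_pos_of_pos_of_nonneg (mul_unitAngle_pos ht.1) (mul_unitAngle_nonneg n t.b)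
  · linarith [mul_unitAngle_lt ht.2.1, mul_unitAngle_lt ht.2.2]

end BeltFrame

section EuclideanSpace

variable {V P : Type*} [NormedAddCommGroup V] [InnerProductSpace ℝ V] [MetricSpace P]
  [NormedAddTorsor V P]

theorem altitudeFoot_eq_smul_vadd {n : ℕ} (hV : Module.finrank ℝ V = n + 1)
    (s : Affine.Simplex ℝ P (n + 1)) {i : Fin (n + 2)} {u : V} {m : ℝ}
    (hu : ‖u‖ = 1) (hm : ∀ j ≠ i, inner ℝ u (s.points j -ᵥ s.points i) = m) :
    s.altitudeFoot i = m • u +ᵥ s.points i := by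
  have : Fact (Module.finrank ℝ V = n + 1) := ⟨hV⟩
  have : FiniteDimensional ℝ V := .of_fact_finrank_eq_succ n
  have hu₀ : u ≠ 0 := norm_ne_zero_iff.1 (by rw [hu]; exact one_ne_zero)
  set Q : P := m • u +ᵥ s.points i
  have inner_eq_zero : ∀ j ≠ i, inner ℝ u (s.points j -ᵥ Q) = 0 := fun j hj => by
    rw [vsub_vadd_eq_vsub_sub, inner_sub_right, hm j hj, real_inner_smul_right,
      real_inner_self_eq_norm_sq, hu, one_pow, mul_one, sub_self]
  have span_eq : affineSpan ℝ (Set.range (s.faceOpposite i).points) = .mk' Q (ℝ ∙ u)ᗮ := by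
    refine (s.faceOpposite i).independent.affineSpan_eq_of_le_of_card_eq_finrank_add_one ?_ ?_
    · rw [affineSpan_le, Affine.Simplex.range_faceOpposite_points]
      rintro _ ⟨j, hj, rfl⟩
      exact AffineSubspace.mem_mk'.2 (Submodule.mem_orthogonal_singleton_iff_inner_right.2
        (inner_eq_zero j hj))
    · rw [AffineSubspace.direction_mk', Submodule.finrank_orthogonal_span_singleton (n := n) hu₀,
        Fintype.card_fin, Nat.add_sub_cancel]
  refine EuclideanGeometry.coe_orthogonalProjection_eq_iff_mem.2 ?_
  rw [span_eq, AffineSubspace.direction_mk', vsub_vadd_eq_vsub_sub, vsub_self, zero_sub]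
  exact ⟨AffineSubspace.self_mem_mk' _ _, neg_mem <| Submodule.smul_mem _ _ <|
    Submodule.le_orthogonal_orthogonal _ (Submodule.mem_span_singleton_self u)⟩

theorem dist_legs_eq {β : ℝ} (hβ : β ≠ 0) {p₀ p₁ p₂ : P} (h₁ : ∠ p₀ p₁ p₂ = β)
    (h₂ : ∠ p₀ p₂ p₁ = β) : dist p₀ p₁ = dist p₀ p₂ :=
  dist_eq_of_angle_eq_angle_of_angle_ne_pi (h₁.trans h₂.symm) fun h =>
    hβ (h₁.symm.trans (angle_eq_pi_iff_sbtw.1 h).angle₂₁₃_eq_zero)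

theorem dist_midpoint_base {p₀ p₁ p₂ : P} (hne : p₁ ≠ p₂) (h : dist p₀ p₁ = dist p₀ p₂) :
    dist p₁ (midpoint ℝ p₁ p₂) = dist p₀ p₁ * cos (∠ p₀ p₁ p₂) ∧
      dist p₀ (midpoint ℝ p₁ p₂) = dist p₀ p₁ * sin (∠ p₀ p₁ p₂) := by
  have right_angle := angle_left_midpoint_eq_pi_div_two_of_dist_eq h
  have base_angle : ∠ (midpoint ℝ p₁ p₂) p₁ p₀ = ∠ p₀ p₁ p₂ := by
    rw [angle_comm, (sbtw_midpoint_of_ne ℝ hne).angle_eq_right]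
  rw [← base_angle, mul_comm, mul_comm (dist p₀ p₁)]
  exact ⟨(cos_angle_mul_dist_of_angle_eq_pi_div_two right_angle).symm,
    (sin_angle_mul_dist_of_angle_eq_pi_div_two right_angle).symm⟩

end EuclideanSpace

theorem sideVector_eq {i : Fin 3} {u : Plane} {m : ℝ} (hu : ‖u‖ = 1) (hm : 0 < m)
    (h : ∀ j ≠ i, inner ℝ u (T.points j - T.points i) = m) :
    sideVector T i = (√2 • u, -(√2 * (inner ℝ u (T.points i) + m))) := by
  have foot_eq : T.altitudeFoot i = m • u + T.points i := altitudeFoot_eq_smul_vadd (by simp) T hu h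
  have outerNormal_eq : outerNormal T i = √2 • u := by
    rw [outerNormal, foot_eq, add_sub_cancel_right, norm_smul, norm_of_nonneg hm.le, hu, mul_one,
      smul_smul, div_mul_cancel₀ _ hm.ne']
  rw [sideVector, outerNormal_eq, foot_eq, real_inner_smul_left, inner_add_right,
    real_inner_smul_right, real_inner_self_eq_norm_sq, hu, one_pow, mul_one, add_comm m]

/-- Cartesian coordinates for an isosceles triangle with apex `0` and base angles `β`: the origin
is the midpoint of the base. -/
structure IsoscelesCoords (T : Affine.Triangle ℝ Plane) (β : ℝ) where
  /-- the midpoint of the base -/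
  M : Plane
  /-- the direction of the base -/
  g : Plane
  /-- the direction of the axis of symmetry -/
  h : Plane
  /-- the length of the legs -/
  l : ℝ
  l_pos : 0 < l
  inner_g_g : inner ℝ g g = (1 : ℝ)
  inner_h_h : inner ℝ h h = (1 : ℝ)
  inner_g_h : inner ℝ g h = (0 : ℝ)
  points_zero : T.points 0 = M + (l * sin β) • h
  points_one : T.points 1 = M + (l * cos β) • g
  points_two : T.points 2 = M - (l * cos β) • g

theorem nonempty_isoscelesCoords {β : ℝ} (hβ : 0 < β) (hβ' : β < π / 2)
    (h₁ : ∠ (T.points 0) (T.points 1) (T.points 2) = β)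
    (h₂ : ∠ (T.points 0) (T.points 2) (T.points 1) = β) : Nonempty (IsoscelesCoords T β) := by
  have sin_pos : 0 < sin β := sin_pos_of_pos_of_lt_pi hβ (hβ'.trans (half_lt_self pi_pos))
  have cos_pos : 0 < cos β := cos_pos_of_mem_Ioo ⟨by linarith, hβ'⟩
  have base_ne : T.points 1 ≠ T.points 2 := T.independent.injective.ne (by decide)
  have legs_eq := dist_legs_eq hβ.ne' h₁ h₂
  obtain ⟨norm_x, norm_y⟩ := dist_midpoint_base base_ne legs_eq
  have inner_y_x := InnerProductGeometry.inner_eq_zero_iff_angle_eq_pi_div_two _ _ |>.2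
    (angle_left_midpoint_eq_pi_div_two_of_dist_eq legs_eq)
  set M : Plane := midpoint ℝ (T.points 1) (T.points 2) with hM
  set l : ℝ := dist (T.points 0) (T.points 1)
  have l_pos : 0 < l := dist_pos.2 (T.independent.injective.ne (by decide))
  rw [h₁, dist_eq_norm] at norm_x norm_y
  simp only [vsub_eq_sub] at inner_y_x
  have points_two_sub : T.points 2 - M = -(T.points 1 - M) := by
    rw [hM, right_sub_midpoint, left_sub_midpoint, ← smul_neg, neg_sub]
  have x_ne : T.points 1 - M ≠ 0 := norm_pos_iff.1 (norm_x ▸ mul_pos l_pos cos_pos)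
  have y_ne : T.points 0 - M ≠ 0 := norm_pos_iff.1 (norm_y ▸ mul_pos l_pos sin_pos)
  have inner_unit : ∀ z : Plane, z ≠ 0 → inner ℝ (‖z‖⁻¹ • z) (‖z‖⁻¹ • z) = (1 : ℝ) :=
    fun z hz => by
      rw [real_inner_self_eq_norm_sq, norm_smul, norm_inv, norm_norm,
        inv_mul_cancel₀ (norm_ne_zero_iff.2 hz), one_pow]
  refine ⟨⟨M, _, _, l, l_pos, inner_unit _ x_ne, inner_unit _ y_ne, ?_, ?_, ?_, ?_⟩⟩
  · rw [real_inner_smul_left, real_inner_smul_right, real_inner_comm, inner_y_x, mul_zero, mul_zero]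
  · rw [← norm_y, smul_inv_smul₀ (norm_ne_zero_iff.2 y_ne), add_sub_cancel]
  · rw [← norm_x, smul_inv_smul₀ (norm_ne_zero_iff.2 x_ne), add_sub_cancel]
  · rw [← norm_x, smul_inv_smul₀ (norm_ne_zero_iff.2 x_ne), sub_eq_add_neg, ← points_two_sub,
      add_sub_cancel]

namespace IsoscelesCoords

variable {β : ℝ} (C : IsoscelesCoords T β)

/-- The unit vector that makes the angle `φ` with `-h`. -/
def unit (φ : ℝ) : Plane := sin φ • C.g - cos φ • C.h

theorem inner_unit_g (φ : ℝ) : inner ℝ (C.unit φ) C.g = sin φ := by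
  rw [unit, inner_sub_left, real_inner_smul_left, real_inner_smul_left, C.inner_g_g,
    (real_inner_comm _ _).trans C.inner_g_h, mul_one, mul_zero, sub_zero]

theorem inner_unit_h (φ : ℝ) : inner ℝ (C.unit φ) C.h = -cos φ := by
  rw [unit, inner_sub_left, real_inner_smul_left, real_inner_smul_left, C.inner_h_h,
    C.inner_g_h, mul_one, mul_zero, zero_sub]

theorem inner_unit_unit (φ ψ : ℝ) : inner ℝ (C.unit φ) (C.unit ψ) = cos (φ - ψ) := by
  rw [unit.eq_1 C ψ, inner_sub_right, real_inner_smul_right, real_inner_smul_right, inner_unit_g,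
    inner_unit_h, cos_sub]
  ring

theorem norm_unit (φ : ℝ) : ‖C.unit φ‖ = 1 := by
  rw [norm_eq_sqrt_real_inner, inner_unit_unit, sub_self, cos_zero, sqrt_one]

theorem inner_unit_points (φ : ℝ) (i : Fin 3) : inner ℝ (C.unit φ) (T.points i) =
    inner ℝ (C.unit φ) C.M + C.l * ![-(sin β * cos φ), cos β * sin φ, -(cos β * sin φ)] i := by
  match i with
  | 0 => rw [C.points_zero, inner_add_right, real_inner_smul_right, inner_unit_h]; simp; ring
  | 1 => rw [C.points_one, inner_add_right, real_inner_smul_right, inner_unit_g]; simp; ring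
  | 2 => rw [C.points_two, inner_sub_right, real_inner_smul_right, inner_unit_g]; simp; ring

/-- The angles of the outer normals of the three sides. -/
def outerAngle (β : ℝ) : Fin 3 → ℝ := ![0, π + β, π - β]

/-- The lengths of the three altitudes. -/
def altitude : Fin 3 → ℝ := ![C.l * sin β, 2 * C.l * cos β * sin β, 2 * C.l * cos β * sin β]

theorem inner_unit_outerAngle {i j : Fin 3} (h : j ≠ i) :
    inner ℝ (C.unit (outerAngle β i)) (T.points j - T.points i) = C.altitude i := by
  rw [inner_sub_right, inner_unit_points, inner_unit_points]
  fin_cases i <;> fin_cases j <;>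
    simp [outerAngle, altitude, sin_add, sin_sub, cos_add, cos_sub] at h ⊢ <;> ring

theorem altitudeFoot_eq (i : Fin 3) :
    T.altitudeFoot i = C.altitude i • C.unit (outerAngle β i) + T.points i :=
  altitudeFoot_eq_smul_vadd (by simp) T (C.norm_unit _) fun _ => C.inner_unit_outerAngle

theorem altitudeFoot_zero : T.altitudeFoot 0 = C.M := by
  rw [C.altitudeFoot_eq, C.points_zero]
  simp [outerAngle, altitude, unit]

theorem altitudeFoot_two :
    T.altitudeFoot 2 = C.M + (C.l * cos β) • C.unit (-(2 * β + π / 2)) := by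
  rw [C.altitudeFoot_eq, C.points_two]
  simp only [outerAngle, altitude, unit, Matrix.cons_val, sin_pi_sub, cos_pi_sub, sin_neg, cos_neg,
    sin_add_pi_div_two, cos_add_pi_div_two, cos_two_mul', sin_two_mul, cos_sq' β]
  module

/-- The frame of the belt line: its direction makes the angle `π - 2 β` with the base. -/
def beltFrame (hβ : 0 < β) (hβ' : β < π / 2) : BeltFrame T where
  e := C.unit (-(2 * β + π / 2))
  f := C.unit (-(2 * β))
  O := C.M
  K := C.l * sin β * sin (2 * β)
  r := C.l * cos β
  inner_e_e := by rw [inner_unit_unit, sub_self, cos_zero]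
  inner_f_f := by rw [inner_unit_unit, sub_self, cos_zero]
  inner_e_f := by
    rw [inner_unit_unit, show -(2 * β + π / 2) - -(2 * β) = -(π / 2) by ring, cos_neg,
      cos_pi_div_two]
  K_pos := mul_pos (mul_pos C.l_pos (sin_pos_of_pos_of_lt_pi hβ (by linarith [pi_pos])))
    (sin_pos_of_pos_of_lt_pi (by linarith) (by linarith))
  r_pos := mul_pos C.l_pos (cos_pos_of_mem_Ioo ⟨by linarith, hβ'⟩)
  beltLine_eq t := by
    rw [beltLine, AffineMap.lineMap_apply, C.altitudeFoot_zero, C.altitudeFoot_two, vsub_eq_sub,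
      vadd_eq_add, add_sub_cancel_left, smul_smul, add_comm]

variable (hβ : 0 < β) (hβ' : β < π / 2)

theorem beltDirection_eq : beltDirection T = (C.beltFrame hβ hβ').e := by
  have r_pos : 0 < C.l * cos β := (C.beltFrame hβ hβ').r_pos
  rw [beltDirection, C.altitudeFoot_zero, C.altitudeFoot_two, add_sub_cancel_left, norm_smul,
    norm_unit, mul_one, norm_of_nonneg r_pos.le, smul_smul, one_div, inv_mul_cancel₀ r_pos.ne',
    one_smul, beltFrame]

theorem normal_beltFrame (θ : ℝ) :
    (C.beltFrame hβ hβ').normal θ = √2 • C.unit (θ + (π - 2 * β)) := by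
  simp only [BeltFrame.normal, beltFrame, unit, sin_neg, cos_neg, sin_add, cos_add, sin_pi_sub,
    cos_pi_sub, sin_pi_div_two, cos_pi_div_two]
  module

theorem altitude_pos (hβ : 0 < β) (hβ' : β < π / 2) (i : Fin 3) : 0 < C.altitude i := by
  have sin_pos : 0 < sin β := sin_pos_of_pos_of_lt_pi hβ (hβ'.trans (half_lt_self pi_pos))
  have cos_pos : 0 < cos β := cos_pos_of_mem_Ioo ⟨by linarith, hβ'⟩
  have l_pos := C.l_pos
  fin_cases i <;> simp only [altitude, Fin.reduceFinMk, Matrix.cons_val] <;> positivity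

theorem sideVector_eq_vec {i : Fin 3} {θ c : ℝ} (hθ : θ + (π - 2 * β) = outerAngle β i)
    (hc : c = -(C.l * ![0, cos β * sin β, cos β * sin β] i)) :
    sideVector T i = (C.beltFrame hβ hβ').vec θ c := by
  have distance_eq : C.l * ![-(sin β * cos (outerAngle β i)), cos β * sin (outerAngle β i),
      -(cos β * sin (outerAngle β i))] i + C.altitude i = -c := by
    subst hc
    fin_cases i <;> simp [outerAngle, altitude, sin_add, sin_sub] <;> ring
  rw [sideVector_eq (C.norm_unit _) (C.altitude_pos hβ hβ' i) fun _ => C.inner_unit_outerAngle,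
    C.inner_unit_points, add_assoc, distance_eq, BeltFrame.vec, normal_beltFrame, hθ,
    real_inner_smul_left]
  exact Prod.ext rfl (by change _ = √2 * c - √2 * inner ℝ (C.unit (outerAngle β i)) C.M; ring)

/-- The two legs correspond to the second and the third vector of the state in opposite order. -/
theorem initialSeed_eq {n : ℕ} (hβn : β = n * unitAngle n) :
    initialSeed n T = (C.beltFrame hβ hβ').seedOf n (initialParam n) := by
  have unitAngle_eq : unitAngle n = π - 2 * β := by
    linarith [two_mul_add_one_mul_unitAngle n]
  have sin_two_pos : 0 < sin (2 * β) := sin_pos_of_pos_of_lt_pi (by linarith) (by linarith)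
  have sin_unitAngle : sin (unitAngle n) = sin (2 * β) := by rw [unitAngle_eq, sin_pi_sub]
  have cos_add_unitAngle : cos (unitAngle n + β) = -cos β := by
    rw [unitAngle_eq, show π - 2 * β + β = π - β by ring, cos_pi_sub]
  set F := C.beltFrame hβ hβ' with hF
  have state_eq : F.labelledSeedOf n (initialParam n) = F.state (unitAngle n) β 0 := by
    simp only [BeltFrame.labelledSeedOf, BeltFrame.orient, initialParam, Nat.cast_one, one_mul, hβn]
  have base_eq : sideVector T 0 = (F.state (unitAngle n) β 0).v 0 := by
    refine C.sideVector_eq_vec hβ hβ' ?_ ?_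
    · simp [outerAngle, unitAngle_eq]
    · simp
  have leg_two_eq : sideVector T 2 = (F.state (unitAngle n) β 0).v 1 := by
    refine C.sideVector_eq_vec hβ hβ' ?_ ?_
    · simp [outerAngle]; ring
    · rw [sin_unitAngle, cos_add_unitAngle, hF, beltFrame]; simp; field_simp
  have leg_one_eq : sideVector T 1 = (F.state (unitAngle n) β 0).v 2 := by
    refine C.sideVector_eq_vec hβ hβ' ?_ ?_
    · simp [outerAngle, unitAngle_eq]; ring
    · rw [sin_unitAngle, hF, beltFrame]; simp; field_simp
  rw [initialSeed, BeltFrame.seedOf, state_eq]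
  refine Quotient.sound ⟨Equiv.swap 1 2, fun i => ?_, fun i j => ?_⟩
  · fin_cases i
    exacts [base_eq.symm, leg_two_eq.symm, leg_one_eq.symm]
  · change BeltFrame.stateMatrix (unitAngle n) β i j = initialMatrix n _ _
    rw [initialMatrix, ← unitAngle, ← hβn]
    fin_cases i <;> fin_cases j <;>
      simp [BeltFrame.stateMatrix, Equiv.swap_apply_def, cos_add_unitAngle]

end IsoscelesCoords

theorem exists_beltFrame {n : ℕ} (hn : 1 ≤ n) (hT : IsInitialTriangle n T) :
    ∃ F : BeltFrame T, F.e = beltDirection T ∧ initialSeed n T = F.seedOf n (initialParam n) := by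
  have hβ : 0 < n * unitAngle n := mul_unitAngle_pos hn
  have hβ' : n * unitAngle n < π / 2 := mul_unitAngle_lt le_rfl
  obtain ⟨C⟩ := nonempty_isoscelesCoords hβ hβ' hT.2.1 hT.2.2
  exact ⟨C.beltFrame hβ hβ', (C.beltDirection_eq hβ hβ').symm, C.initialSeed_eq hβ hβ' rfl⟩

theorem eq_zero_of_sum_abs_lt {G : Type*} [Group G] [Fintype G] [DecidableEq G] {c q : G → ℝ}
    (hc : ∑ g ∈ Finset.univ.erase 1, |c g| < |c 1|) (hq : ∀ a, ∑ g, c (a * g) * q g = 0) :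
    q = 0 := by
  let A : Matrix G G ℝ := .of fun a g => c (a⁻¹ * g)
  have det_ne_zero : A.det ≠ 0 := det_ne_zero_of_sum_row_lt_diag fun a => by
    simp only [A, Matrix.of_apply, inv_mul_cancel, norm_eq_abs]
    refine hc.trans_eq' (Finset.sum_equiv (Equiv.mulLeft a) (fun g => ?_) fun g _ => ?_)
    · simp
    · simp
  exact Matrix.eq_zero_of_mulVec_eq_zero det_ne_zero (funext fun a => hq a⁻¹)

/-- The group of units modulo `2 n + 1` up to sign, which indexes the conjugates of
`1 / sin² (π / (2 n + 1))`. -/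
abbrev UnitsModSign (n : ℕ) : Type :=
  (ZMod (2 * n + 1))ˣ ⧸ Subgroup.zpowers (-1 : (ZMod (2 * n + 1))ˣ)

section UnitsModSign

variable {n : ℕ}

theorem unitsModSign_mk_eq_mk_iff {u v : (ZMod (2 * n + 1))ˣ} :
    (u : UnitsModSign n) = v ↔ (u : ZMod (2 * n + 1)).valMinAbs.natAbs =
      (v : ZMod (2 * n + 1)).valMinAbs.natAbs := by
  have mem_zpowers_iff : ∀ w : (ZMod (2 * n + 1))ˣ,
      w ∈ Subgroup.zpowers (-1) ↔ w = 1 ∨ w = -1 := fun w => by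
    refine ⟨?_, ?_⟩
    · rintro ⟨k, rfl⟩
      exact k.even_or_odd.imp (fun h => h.neg_one_zpow) fun h => h.neg_one_zpow
    · rintro (rfl | rfl)
      exacts [one_mem _, Subgroup.mem_zpowers _]
  rw [QuotientGroup.eq, mem_zpowers_iff, inv_mul_eq_one, inv_mul_eq_iff_eq_mul, mul_neg, mul_one,
    eq_comm (a := v), neg_eq_iff_eq_neg, ZMod.natAbs_valMinAbs_eq_natAbs_valMinAbs,
    Units.ext_iff, Units.ext_iff, Units.val_neg]

theorem two_mul_card_unitsModSign (hn : 1 ≤ n) :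
    2 * Nat.card (UnitsModSign n) = Nat.totient (2 * n + 1) := by
  have : Fact (1 < 2 * n + 1) := ⟨by omega⟩
  have order_eq : Nat.card (Subgroup.zpowers (-1 : (ZMod (2 * n + 1))ˣ)) = 2 := by
    rw [Nat.card_zpowers, ← orderOf_units, Units.val_neg, Units.val_one, orderOf_neg_one,
      if_neg (by rw [ZMod.ringChar_zmod_n]; omega)]
  rw [← ZMod.card_units_eq_totient, ← Nat.card_eq_fintype_card,
    Subgroup.card_eq_card_quotient_mul_card_subgroup
      (Subgroup.zpowers (-1 : (ZMod (2 * n + 1))ˣ)), order_eq, mul_comm]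

theorem one_le_natAbs_valMinAbs (hn : 1 ≤ n) (u : (ZMod (2 * n + 1))ˣ) :
    1 ≤ (u : ZMod (2 * n + 1)).valMinAbs.natAbs := by
  have : Fact (1 < 2 * n + 1) := ⟨by omega⟩
  rw [Nat.one_le_iff_ne_zero, Int.natAbs_ne_zero, Ne, ZMod.valMinAbs_eq_zero]
  exact u.ne_zero

theorem natAbs_valMinAbs_le (x : ZMod (2 * n + 1)) : x.valMinAbs.natAbs ≤ n :=
  x.natAbs_valMinAbs_le.trans (by omega)

theorem natCast_natAbs_valMinAbs (x : ZMod (2 * n + 1)) :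
    (x.valMinAbs.natAbs : ZMod (2 * n + 1)) = x ∨ (x.valMinAbs.natAbs : ZMod (2 * n + 1)) = -x := by
  rw [← ZMod.natAbs_valMinAbs_eq_natAbs_valMinAbs, ZMod.valMinAbs_natCast_of_le_half,
    Int.natAbs_natCast]
  exact x.natAbs_valMinAbs_le

theorem coprime_natAbs_valMinAbs (u : (ZMod (2 * n + 1))ˣ) :
    (2 * n + 1).Coprime (u : ZMod (2 * n + 1)).valMinAbs.natAbs := by
  refine ((ZMod.isUnit_iff_coprime _ _).1 ?_).symm
  rcases natCast_natAbs_valMinAbs (u : ZMod (2 * n + 1)) with h | h <;> rw [h]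
  exacts [u.isUnit, u.isUnit.neg]

end UnitsModSign

/-- The number `1 / sin² (x α)`, where `α = π / (2 n + 1)`. -/
def cosecSq (n : ℕ) (x : ZMod (2 * n + 1)) : ℝ := 1 / sin (x.val * unitAngle n) ^ 2

section CosecSq

variable (n : ℕ)

theorem cosecSq_nonneg (x : ZMod (2 * n + 1)) : 0 ≤ cosecSq n x := by
  unfold cosecSq; positivity

theorem cosecSq_natCast (m : ℕ) : cosecSq n m = 1 / sin (m * unitAngle n) ^ 2 := by
  have angle_eq : (m : ℝ) * unitAngle n =
      (m % (2 * n + 1) : ℕ) * unitAngle n + (m / (2 * n + 1) : ℕ) * π := by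
    have div_add_mod : (m : ℝ) = (m % (2 * n + 1) : ℕ) + (2 * n + 1) * (m / (2 * n + 1) : ℕ) := by
      exact_mod_cast (Nat.mod_add_div m (2 * n + 1)).symm
    linear_combination unitAngle n * div_add_mod +
      (m / (2 * n + 1) : ℕ) * two_mul_add_one_mul_unitAngle n
  rw [cosecSq, ZMod.val_natCast, angle_eq, sin_add_nat_mul_pi, mul_pow, pow_right_comm,
    neg_one_sq, one_pow, one_mul]

theorem cosecSq_neg (x : ZMod (2 * n + 1)) : cosecSq n (-x) = cosecSq n x := by
  have neg_eq : -x = ((2 * n + 1 - x.val : ℕ) : ZMod (2 * n + 1)) := by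
    rw [Nat.cast_sub x.val_lt.le, ZMod.natCast_self, ZMod.natCast_zmod_val, zero_sub]
  rw [neg_eq, cosecSq_natCast, cosecSq, Nat.cast_sub x.val_lt.le, sub_mul, Nat.cast_add,
    Nat.cast_mul, Nat.cast_two, Nat.cast_one, two_mul_add_one_mul_unitAngle, sin_pi_sub]

variable {n}

theorem cosecSq_natAbs_valMinAbs (x : ZMod (2 * n + 1)) :
    cosecSq n x.valMinAbs.natAbs = cosecSq n x := by
  rcases natCast_natAbs_valMinAbs x with h | h <;> rw [h]
  exact cosecSq_neg n x

theorem cosecSq_eq_of_mk_eq {u v : (ZMod (2 * n + 1))ˣ} (h : (u : UnitsModSign n) = v) :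
    cosecSq n u = cosecSq n v := by
  rw [← cosecSq_natAbs_valMinAbs, unitsModSign_mk_eq_mk_iff.1 h, cosecSq_natAbs_valMinAbs]

theorem cot_sub_cot {x y : ℝ} (hx : sin x ≠ 0) (hy : sin y ≠ 0) :
    cot x - cot y = sin (y - x) / (sin x * sin y) := by
  rw [cot_eq_cos_div_sin, cot_eq_cos_div_sin, sin_sub]
  field_simp

theorem sin_mul_unitAngle_pos {m : ℕ} (hm : 1 ≤ m) (hmn : m ≤ n) : 0 < sin (m * unitAngle n) :=
  sin_pos_of_pos_of_lt_pi (mul_unitAngle_pos hm)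
    ((mul_unitAngle_lt hmn).trans (half_lt_self pi_pos))

theorem cosecSq_add_one_le {m : ℕ} (hm : 1 ≤ m) (hmn : m + 1 ≤ n) :
    cosecSq n (m + 1 : ℕ) ≤
      (cot (m * unitAngle n) - cot ((m + 1 : ℕ) * unitAngle n)) / sin (unitAngle n) := by
  have sin_pos := sin_mul_unitAngle_pos (le_refl 1) (show 1 ≤ n by omega)
  have sin_m_pos := sin_mul_unitAngle_pos hm (show m ≤ n by omega)
  have sin_succ_pos := sin_mul_unitAngle_pos (show 1 ≤ m + 1 by omega) hmn
  have sin_le : sin (m * unitAngle n) ≤ sin ((m + 1 : ℕ) * unitAngle n) := by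
    refine sin_le_sin_of_le_of_le_pi_div_two ?_ (mul_unitAngle_lt hmn).le ?_
    · linarith [pi_pos, mul_unitAngle_nonneg n m]
    · exact mul_le_mul_of_nonneg_right (by exact_mod_cast m.le_succ) (unitAngle_pos n).le
  rw [Nat.cast_one, one_mul] at sin_pos
  have angle_sub : (m + 1 : ℕ) * unitAngle n - m * unitAngle n = unitAngle n := by
    push_cast; ring
  rw [cot_sub_cot sin_m_pos.ne' sin_succ_pos.ne', angle_sub, div_right_comm, div_self sin_pos.ne',
    cosecSq_natCast, sq]
  gcongr

theorem sum_cosecSq_lt (hn : 1 ≤ n) :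
    ∑ m ∈ Finset.Icc 2 n, cosecSq n (m : ℕ) < cosecSq n 1 := by
  have sum_le : ∀ k, 1 ≤ k → k ≤ n → ∑ m ∈ Finset.Icc 2 k, cosecSq n (m : ℕ) ≤
      (cot (unitAngle n) - cot (k * unitAngle n)) / sin (unitAngle n) := fun k hk => by
    induction k, hk using Nat.le_induction with
    | base => simp
    | succ k hk ih =>
      intro hkn
      rw [Finset.sum_Icc_succ_top (by omega)]
      refine (add_le_add (ih (by omega)) (cosecSq_add_one_le hk hkn)).trans_eq ?_
      rw [← add_div, sub_add_sub_cancel]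
  have sin_pos := sin_mul_unitAngle_pos (le_refl 1) hn
  have cot_nonneg : 0 ≤ cot (n * unitAngle n) := by
    rw [cot_eq_cos_div_sin]
    exact div_nonneg (cos_nonneg_of_neg_pi_div_two_le_of_le (by
      linarith [pi_pos, mul_unitAngle_nonneg n n]) (mul_unitAngle_lt le_rfl).le)
      (sin_mul_unitAngle_pos hn le_rfl).le
  rw [Nat.cast_one, one_mul] at sin_pos
  have cos_lt : cos (unitAngle n) < 1 := by
    nlinarith [sin_sq_add_cos_sq (unitAngle n), cos_le_one (unitAngle n)]
  calc ∑ m ∈ Finset.Icc 2 n, cosecSq n (m : ℕ)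
      ≤ (cot (unitAngle n) - cot (n * unitAngle n)) / sin (unitAngle n) := sum_le n hn le_rfl
    _ ≤ cot (unitAngle n) / sin (unitAngle n) := by gcongr; linarith
    _ = cos (unitAngle n) / sin (unitAngle n) ^ 2 := by rw [cot_eq_cos_div_sin, div_div, sq]
    _ < 1 / sin (unitAngle n) ^ 2 := by gcongr
    _ = cosecSq n 1 := by simpa using (cosecSq_natCast n 1).symm

theorem sum_abs_cosecSq_lt [DecidableEq (UnitsModSign n)] (hn : 1 ≤ n) :
    ∑ g ∈ Finset.univ.erase (1 : UnitsModSign n), |cosecSq n g.out| <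
      |cosecSq n (1 : UnitsModSign n).out| := by
  let index : UnitsModSign n → ℕ := fun g => (g.out : ZMod (2 * n + 1)).valMinAbs.natAbs
  have index_eq_iff : ∀ (g : UnitsModSign n) (u : (ZMod (2 * n + 1))ˣ),
      index g = (u : ZMod (2 * n + 1)).valMinAbs.natAbs ↔ g = u := fun g u => by
    rw [← unitsModSign_mk_eq_mk_iff, QuotientGroup.out_eq']
  have index_injective : Function.Injective index := fun g h hgh => by
    rw [(index_eq_iff g h.out).1 hgh, QuotientGroup.out_eq']
  have natAbs_one : (1 : ZMod (2 * n + 1)).valMinAbs.natAbs = 1 := by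
    have valMinAbs_one := ZMod.valMinAbs_natCast_of_le_half (n := 2 * n + 1) (a := 1) (by omega)
    rw [← Nat.cast_one (R := ZMod (2 * n + 1)), valMinAbs_one, Int.natAbs_natCast]
  have image_subset : (Finset.univ.erase 1).image index ⊆ Finset.Icc 2 n := fun m hm => by
    obtain ⟨g, hg, rfl⟩ := Finset.mem_image.1 hm
    have index_ne_one : index g ≠ 1 := fun h =>
      (Finset.mem_erase.1 hg).1 ((index_eq_iff g 1).1 (h.trans natAbs_one.symm))
    have one_le_index : 1 ≤ index g := one_le_natAbs_valMinAbs hn g.out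
    exact Finset.mem_Icc.2 ⟨by omega, natAbs_valMinAbs_le _⟩
  calc ∑ g ∈ Finset.univ.erase (1 : UnitsModSign n), |cosecSq n g.out|
      = ∑ m ∈ (Finset.univ.erase 1).image index, cosecSq n (m : ℕ) := by
        rw [Finset.sum_image index_injective.injOn]
        refine Finset.sum_congr rfl fun g _ => ?_
        rw [cosecSq_natAbs_valMinAbs, abs_of_nonneg (cosecSq_nonneg n _)]
    _ ≤ ∑ m ∈ Finset.Icc 2 n, cosecSq n (m : ℕ) :=
        Finset.sum_le_sum_of_subset_of_nonneg image_subset fun _ _ _ => cosecSq_nonneg n _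
    _ < cosecSq n 1 := sum_cosecSq_lt hn
    _ = |cosecSq n (1 : UnitsModSign n).out| := by
        rw [abs_of_nonneg (cosecSq_nonneg n _), ← Units.val_one]
        exact cosecSq_eq_of_mk_eq (QuotientGroup.out_eq' _).symm

end CosecSq

open scoped IntermediateField

/-- A primitive root of unity of order `2 n + 1`; the cyclotomic field which it generates contains
`exp (i α)`, where `α = π / (2 n + 1)`. -/
def rootOfUnity (n : ℕ) : ℂ := Complex.exp (2 * π * Complex.I / (2 * n + 1 : ℕ))

section Conjugation

variable {n : ℕ}

theorem isPrimitiveRoot_rootOfUnity (n : ℕ) : IsPrimitiveRoot (rootOfUnity n) (2 * n + 1) :=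
  Complex.isPrimitiveRoot_exp _ (by omega)

theorem exists_algHom_gen_eq {N : ℕ} (hN : 0 < N) {z w : ℂ} (hz : IsPrimitiveRoot z N)
    (hw : IsPrimitiveRoot w N) :
    ∃ φ : ℚ⟮z⟯ →ₐ[ℚ] ℂ, φ (IntermediateField.AdjoinSimple.gen ℚ z) = w := by
  have isIntegral : IsIntegral ℚ z := (hz.isIntegral hN).tower_top
  have isRoot : w ∈ (minpoly ℚ z).aroots ℂ := by
    rw [Polynomial.mem_aroots, ← Polynomial.cyclotomic_eq_minpoly_rat hz hN,
      Polynomial.cyclotomic_eq_minpoly_rat hw hN]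
    exact ⟨minpoly.ne_zero (hw.isIntegral hN).tower_top, minpoly.aeval ℚ w⟩
  exact ⟨(IntermediateField.algHomAdjoinIntegralEquiv ℚ isIntegral).symm ⟨w, isRoot⟩,
    IntermediateField.algHomAdjoinIntegralEquiv_symm_apply_gen ℚ isIntegral ⟨w, isRoot⟩⟩

theorem ofReal_cosecSq (n m : ℕ) : (cosecSq n m : ℂ) =
    -4 * rootOfUnity n ^ m / (rootOfUnity n ^ m - 1) ^ 2 := by
  let x : ℂ := Complex.exp ((m * unitAngle n : ℝ) * Complex.I)
  have x_ne_zero : x ≠ 0 := Complex.exp_ne_zero _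
  have root_pow_eq : rootOfUnity n ^ m = x ^ 2 := by
    rw [rootOfUnity, ← Complex.exp_nat_mul, ← Complex.exp_nat_mul, unitAngle]
    congr 1
    push_cast
    ring
  have sin_eq : ((sin (m * unitAngle n) : ℝ) : ℂ) = (x⁻¹ - x) * Complex.I / 2 := by
    rw [Complex.ofReal_sin, Complex.sin, neg_mul, Complex.exp_neg]
  have sin_sq_eq : ((sin (m * unitAngle n) : ℝ) : ℂ) ^ 2 = -(x ^ 2 - 1) ^ 2 / (4 * x ^ 2) := by
    rw [sin_eq, div_pow, mul_pow, Complex.I_sq]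
    field_simp
    ring
  rw [cosecSq_natCast, Complex.ofReal_div, Complex.ofReal_pow, sin_sq_eq, root_pow_eq,
    Complex.ofReal_one, one_div_div, div_neg, neg_mul, neg_div]

theorem map_gen_eq_cosecSq {φ : ℚ⟮rootOfUnity n⟯ →ₐ[ℚ] ℂ} {j : ℕ}
    (hφ : φ (IntermediateField.AdjoinSimple.gen ℚ (rootOfUnity n)) = rootOfUnity n ^ j) (m : ℕ) :
    φ (-4 * IntermediateField.AdjoinSimple.gen ℚ (rootOfUnity n) ^ m /
      (IntermediateField.AdjoinSimple.gen ℚ (rootOfUnity n) ^ m - 1) ^ 2) =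
      cosecSq n (j * m : ℕ) := by
  rw [ofReal_cosecSq, map_div₀, map_mul, map_neg, map_ofNat, map_pow, map_pow, map_sub, map_pow,
    map_one, hφ, ← pow_mul]

theorem sum_cosecSq_mul_eq_zero {ι : Type*} [Fintype ι] {q : ι → ℚ} {m : ι → ZMod (2 * n + 1)}
    (h : ∑ i, q i * cosecSq n (m i) = 0) (a : (ZMod (2 * n + 1))ˣ) :
    ∑ i, q i * cosecSq n (a * m i) = 0 := by
  let ζ := IntermediateField.AdjoinSimple.gen ℚ (rootOfUnity n)
  let relation : ℚ⟮rootOfUnity n⟯ :=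
    ∑ i, algebraMap ℚ _ (q i) * (-4 * ζ ^ (m i).val / (ζ ^ (m i).val - 1) ^ 2)
  have map_relation : ∀ (φ : ℚ⟮rootOfUnity n⟯ →ₐ[ℚ] ℂ) (j : ℕ), φ ζ = rootOfUnity n ^ j →
      φ relation = (∑ i, q i * cosecSq n (j * m i) : ℝ) := fun φ j hφ => by
    rw [map_sum, Complex.ofReal_sum]
    refine Finset.sum_congr rfl fun i _ => ?_
    rw [map_mul, AlgHom.commutes, map_gen_eq_cosecSq hφ, Nat.cast_mul, ZMod.natCast_zmod_val,
      Complex.ofReal_mul, Complex.ofReal_ratCast, eq_ratCast]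
  have relation_eq_zero : relation = 0 := by
    refine (map_eq_zero_iff (ℚ⟮rootOfUnity n⟯.val) (ℚ⟮rootOfUnity n⟯.val).injective).1 ?_
    refine (map_relation ℚ⟮rootOfUnity n⟯.val 1 (pow_one (rootOfUnity n)).symm).trans ?_
    simp only [Nat.cast_one, one_mul, h, Complex.ofReal_zero]
  obtain ⟨φ, hφ⟩ := exists_algHom_gen_eq (by omega) (isPrimitiveRoot_rootOfUnity n)
    ((isPrimitiveRoot_rootOfUnity n).pow_of_coprime _ (ZMod.val_coe_unit_coprime a))
  have map_eq := map_relation φ _ hφ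
  rw [relation_eq_zero, map_zero, ZMod.natCast_zmod_val] at map_eq
  exact_mod_cast map_eq.symm

theorem linearIndependent_cosecSq (hn : 1 ≤ n) :
    LinearIndependent ℚ fun g : UnitsModSign n => cosecSq n g.out := by
  classical
  rw [Fintype.linearIndependent_iff]
  intro q hq
  have conjugates_eq_zero : ∀ a : UnitsModSign n,
      ∑ g, cosecSq n (a * g).out * (q g : ℝ) = 0 := fun a => by
    rw [← sum_cosecSq_mul_eq_zero (q := q) (m := fun g => (g.out : ZMod (2 * n + 1)))
      (by simpa only [Rat.smul_def] using hq) a.out]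
    refine Finset.sum_congr rfl fun g _ => ?_
    rw [mul_comm, ← Units.val_mul, cosecSq_eq_of_mk_eq]
    rw [QuotientGroup.mk_mul, QuotientGroup.out_eq', QuotientGroup.out_eq', QuotientGroup.out_eq']
  have eq_zero := eq_zero_of_sum_abs_lt (sum_abs_cosecSq_lt hn) conjugates_eq_zero
  exact fun g => Rat.cast_eq_zero.1 (congrFun eq_zero g)

end Conjugation

section RealSubfield

/-- The real numbers in a field of complex numbers. -/
def realSubfield (K : IntermediateField ℚ ℂ) : IntermediateField ℚ ℝ :=
  K.comap (Complex.ofRealAm.restrictScalars ℚ)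

theorem mem_realSubfield {K : IntermediateField ℚ ℂ} {x : ℝ} :
    x ∈ realSubfield K ↔ (x : ℂ) ∈ K := Iff.rfl

/-- The inclusion of the real numbers in a field of complex numbers. -/
def realSubfieldInclusion (K : IntermediateField ℚ ℂ) : realSubfield K →ₐ[ℚ] K :=
  ((Complex.ofRealAm.restrictScalars ℚ).comp (realSubfield K).val).codRestrict K.toSubalgebra
    fun x => x.2

theorem finite_realSubfield (K : IntermediateField ℚ ℂ) [Module.Finite ℚ K] :
    Module.Finite ℚ (realSubfield K) :=
  Module.Finite.of_injective (realSubfieldInclusion K).toLinearMap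
    (realSubfieldInclusion K).injective

theorem two_mul_finrank_realSubfield_le {K : IntermediateField ℚ ℂ} [Module.Finite ℚ K] {z : ℂ}
    (hzK : z ∈ K) (hz : z.im ≠ 0) :
    2 * Module.finrank ℚ (realSubfield K) ≤ Module.finrank ℚ K := by
  have : Module.Finite ℚ (realSubfield K) := finite_realSubfield K
  let g := (realSubfieldInclusion K).toLinearMap
  let addMul : realSubfield K × realSubfield K →ₗ[ℚ] K :=
    g.coprod (LinearMap.mulLeft ℚ (⟨z, hzK⟩ : K) ∘ₗ g)
  have addMul_injective : Function.Injective addMul := by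
    refine (injective_iff_map_eq_zero addMul).2 fun ⟨x, y⟩ hxy => ?_
    have eq_zero : ((x : ℝ) : ℂ) + z * ((y : ℝ) : ℂ) = 0 := congrArg Subtype.val hxy
    have y_eq_zero : (y : ℝ) = 0 := by
      simpa [hz] using congrArg Complex.im eq_zero
    have x_eq_zero : (x : ℝ) = 0 := by
      simpa [y_eq_zero] using congrArg Complex.re eq_zero
    exact Prod.ext (Subtype.ext x_eq_zero) (Subtype.ext y_eq_zero)
  rw [two_mul, ← Module.finrank_prod]
  exact LinearMap.finrank_le_finrank_of_injective addMul_injective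

end RealSubfield

/-- The real subfield of the cyclotomic field of order `2 n + 1`. -/
abbrev realCyclotomic (n : ℕ) : IntermediateField ℚ ℝ := realSubfield ℚ⟮rootOfUnity n⟯

section RealCyclotomic

theorem exp_mem_adjoin_rootOfUnity (n k : ℕ) :
    Complex.exp ((k * unitAngle n : ℝ) * Complex.I) ∈ ℚ⟮rootOfUnity n⟯ := by
  have exp_eq : Complex.exp ((k * unitAngle n : ℝ) * Complex.I) =
      (-rootOfUnity n ^ (n + 1)) ^ k := by
    have arg_eq : (unitAngle n : ℝ) * Complex.I =
        (n + 1 : ℕ) * (2 * π * Complex.I / (2 * n + 1 : ℕ)) - π * Complex.I := by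
      have ne_zero : ((2 * n + 1 : ℕ) : ℂ) ≠ 0 := by exact_mod_cast (2 * n).succ_ne_zero
      rw [unitAngle]
      push_cast at ne_zero ⊢
      field_simp
      ring
    rw [Complex.ofReal_mul, Complex.ofReal_natCast, mul_assoc, Complex.exp_nat_mul, arg_eq,
      Complex.exp_sub, Complex.exp_pi_mul_I, div_neg, div_one, Complex.exp_nat_mul, rootOfUnity]
  rw [exp_eq]
  exact pow_mem (neg_mem (pow_mem (IntermediateField.mem_adjoin_simple_self ℚ _) _)) k

theorem cos_mem_realCyclotomic (n k : ℕ) : cos (k * unitAngle n) ∈ realCyclotomic n := by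
  have exp_mem := exp_mem_adjoin_rootOfUnity n k
  rw [mem_realSubfield, Complex.ofReal_cos, Complex.cos, neg_mul, Complex.exp_neg]
  exact div_mem (add_mem exp_mem (inv_mem exp_mem)) (ofNat_mem _ 2)

theorem increment_mem_realCyclotomic (n a b : ℕ) : increment n a b ∈ realCyclotomic n := by
  have sin_mul_sin_eq : sin (a * unitAngle n) * sin (a * unitAngle n + b * unitAngle n) =
      (cos (b * unitAngle n) - cos ((2 * a + b : ℕ) * unitAngle n)) / 2 := by
    have half_add : ((b : ℝ) * unitAngle n + (2 * a + b : ℕ) * unitAngle n) / 2 =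
        a * unitAngle n + b * unitAngle n := by push_cast; ring
    have half_sub : ((b : ℝ) * unitAngle n - (2 * a + b : ℕ) * unitAngle n) / 2 =
        -(a * unitAngle n) := by push_cast; ring
    rw [cos_sub_cos, half_add, half_sub, sin_neg]
    ring
  rw [increment, BeltFrame.displacement, sin_mul_sin_eq]
  exact div_mem (cos_mem_realCyclotomic n b)
    (div_mem (sub_mem (cos_mem_realCyclotomic n b) (cos_mem_realCyclotomic n _)) (ofNat_mem _ 2))

theorem finite_adjoin_rootOfUnity (n : ℕ) : Module.Finite ℚ ℚ⟮rootOfUnity n⟯ :=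
  IntermediateField.adjoin.finiteDimensional
    ((isPrimitiveRoot_rootOfUnity n).isIntegral (by omega)).tower_top

theorem finrank_adjoin_rootOfUnity (n : ℕ) :
    Module.finrank ℚ ℚ⟮rootOfUnity n⟯ = Nat.totient (2 * n + 1) := by
  have isPrimitiveRoot := isPrimitiveRoot_rootOfUnity n
  rw [IntermediateField.adjoin.finrank (isPrimitiveRoot.isIntegral (by omega)).tower_top,
    ← Polynomial.cyclotomic_eq_minpoly_rat isPrimitiveRoot (by omega),
    Polynomial.natDegree_cyclotomic]

theorem finite_realCyclotomic (n : ℕ) : Module.Finite ℚ (realCyclotomic n) :=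
  have := finite_adjoin_rootOfUnity n
  finite_realSubfield _

theorem two_mul_finrank_realCyclotomic_le {n : ℕ} (hn : 1 ≤ n) :
    2 * Module.finrank ℚ (realCyclotomic n) ≤ Nat.totient (2 * n + 1) := by
  have := finite_adjoin_rootOfUnity n
  rw [← finrank_adjoin_rootOfUnity]
  refine two_mul_finrank_realSubfield_le (exp_mem_adjoin_rootOfUnity n 1) ?_
  rw [Complex.exp_ofReal_mul_I_im]
  exact (sin_mul_unitAngle_pos le_rfl hn).ne'

end RealCyclotomic

section Rank

variable {A V : Type*} [AddCommGroup A] [AddCommGroup V] [Module ℚ V]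

theorem finrank_int_le_finrank_rat [Module.Finite ℤ A] [Module.Free ℤ A] [Module.Finite ℚ V]
    {f : A →+ V} (hf : Function.Injective f) : Module.finrank ℤ A ≤ Module.finrank ℚ V := by
  have linearIndependent := (Module.finBasis ℤ A).linearIndependent.map' f.toIntLinearMap
    (LinearMap.ker_eq_bot.2 hf)
  rw [LinearIndependent.iff_fractionRing ℤ ℚ] at linearIndependent
  simpa using linearIndependent.fintype_card_le_finrank

theorem card_le_finrank_int {H : AddSubgroup V} [Module.Finite ℤ H] {ι : Type*} [Finite ι]
    {v : ι → V} (hv : LinearIndependent ℚ v) (hmem : ∀ i, v i ∈ H) :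
    Nat.card ι ≤ Module.finrank ℤ H := by
  have := Fintype.ofFinite ι
  rw [← LinearIndependent.iff_fractionRing ℤ ℚ] at hv
  have linearIndependent : LinearIndependent ℤ fun i => (⟨v i, hmem i⟩ : H) :=
    .of_comp H.subtype.toIntLinearMap hv
  rw [Nat.card_eq_fintype_card]
  exact linearIndependent.fintype_card_le_finrank

end Rank

/-- The parameters that are reached from those of the initial seed. -/
def IsReachable (n : ℕ) (K : ℝ) (s : SeedParam) : Prop :=
  Relation.ReflTransGen (Step n K) (initialParam n) s

theorem IsReachable.valid {n : ℕ} {K : ℝ} {s : SeedParam} (hn : 1 ≤ n) (hs : IsReachable n K s) :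
    s.Valid n :=
  hs.cases_tail.elim (fun h => h ▸ initialParam_valid hn) fun ⟨_, _, h⟩ => h.valid

/-- The translations along the belt line that preserve the set of reachable parameters. -/
def periods (n : ℕ) (K : ℝ) : AddSubgroup ℝ where
  carrier := {u | IsReachable n K ((initialParam n).shift u)}
  zero_mem' := by
    rw [Set.mem_ofPred_eq, SeedParam.shift_zero]
    exact .refl
  add_mem' {u v} hu hv := by
    have reachable := hv.trans (reflTransGen_step_shift v hu)
    rwa [SeedParam.shift_shift, add_comm] at reachable
  neg_mem' {u} hu := by
    have reachable := symm (reflTransGen_step_shift (-u) hu)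
    rwa [SeedParam.shift_shift, neg_add_cancel, SeedParam.shift_zero] at reachable

section Periods

variable {n : ℕ} {K u : ℝ} {s t : SeedParam}

theorem IsReachable.shift (hs : IsReachable n K s) (hu : u ∈ periods n K) :
    IsReachable n K (s.shift u) :=
  Relation.ReflTransGen.trans hu (reflTransGen_step_shift u hs)

theorem IsReachable.mem_periods (hs : IsReachable n K s) (hu : IsReachable n K (s.shift u)) :
    u ∈ periods n K :=
  hu.trans (symm (reflTransGen_step_shift u hs))

variable {H : AddSubgroup ℝ} (hH : ∀ a ≤ n, ∀ b ≤ n, K * increment n a b ∈ H)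
include hH

theorem Move.sub_mem {i j : Fin 3} (h : Move n K i j s t) : t.p - s.p ∈ H := by
  cases h with
  | up ε a b p ha hab => simp
  | right ε a b p ha hab => simpa using hH a (by omega) b (by omega)
  | turn ε a b p ha hb hab => simpa using hH a ha b hb

theorem Step.sub_mem (h : Step n K s t) : t.p - s.p ∈ H := by
  obtain ⟨i, j, h | h⟩ := h
  · exact h.sub_mem hH
  · exact sub_mem_comm_iff.1 (h.sub_mem hH)

theorem periods_le : periods n K ≤ H := fun u hu => by
  have sub_mem : ∀ t, IsReachable n K t → t.p - (initialParam n).p ∈ H := fun t ht => by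
    induction ht with
    | refl => simp
    | tail _ step ih => simpa using add_mem (step.sub_mem hH) ih
  simpa [SeedParam.shift] using sub_mem _ hu

end Periods

theorem finite_periods (n : ℕ) (K : ℝ) : Module.Finite ℤ (periods n K) := by
  let S : Set ℝ := (fun x : ℕ × ℕ => K * increment n x.1 x.2) '' (Set.Iic n ×ˢ Set.Iic n)
  have isNoetherian_span := isNoetherian_span_of_finite ℤ
    (((Set.finite_Iic n).prod (Set.finite_Iic n)).image _ : S.Finite)
  have periods_le_span : AddSubgroup.toIntSubmodule (periods n K) ≤ Submodule.span ℤ S :=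
    periods_le (H := (Submodule.span ℤ S).toAddSubgroup) fun a ha b hb =>
      Submodule.subset_span ⟨(a, b), ⟨ha, hb⟩, rfl⟩
  exact Module.Finite.iff_fg.2 (isNoetherian_submodule.1 isNoetherian_span _ periods_le_span)

theorem two_mul_finrank_periods_le {n : ℕ} (hn : 1 ≤ n) {K : ℝ} (hK : K ≠ 0) :
    2 * Module.finrank ℤ (periods n K) ≤ Nat.totient (2 * n + 1) := by
  have := finite_realCyclotomic n
  have := finite_periods n K
  have mem_realCyclotomic : ∀ u ∈ periods n K, K⁻¹ * u ∈ realCyclotomic n :=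
    periods_le (H := (realCyclotomic n).toSubfield.toAddSubgroup.comap
      (AddMonoidHom.mulLeft K⁻¹)) fun a _ b _ => by
      change K⁻¹ * (K * increment n a b) ∈ realCyclotomic n
      rw [inv_mul_cancel_left₀ hK]
      exact increment_mem_realCyclotomic n a b
  let rescale : periods n K →+ realCyclotomic n :=
    ((AddMonoidHom.mulLeft K⁻¹).comp (periods n K).subtype).codRestrict (realCyclotomic n)
      fun u => mem_realCyclotomic u u.2
  have rescale_injective : Function.Injective rescale := fun u v h =>
    Subtype.ext (mul_left_cancel₀ (inv_ne_zero hK) (congrArg Subtype.val h))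
  exact (Nat.mul_le_mul_left 2 (finrank_int_le_finrank_rat rescale_injective)).trans
    (two_mul_finrank_realCyclotomic_le hn)

/-- Parameters with the given orientation and angles are reachable for some position. -/
def Occurs (n : ℕ) (K : ℝ) (ε : Bool) (a b : ℕ) : Prop := ∃ p, IsReachable n K ⟨ε, a, b, p⟩

section Occurs

variable {n a b k : ℕ} {K : ℝ} {ε : Bool}

theorem occurs_up_iff (ha : 1 ≤ a) (hab : a + b ≤ n) :
    Occurs n K ε a (a + b) ↔ Occurs n K ε a b :=
  exists_congr fun p =>
    have step := (Move.up (K := K) ε a b p ha hab).step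
    ⟨fun h => h.tail (symm step), fun h => h.tail step⟩

theorem occurs_right_iff (ha : 1 ≤ a) (hab : a + b ≤ n) :
    Occurs n K ε (a + b) b ↔ Occurs n K ε a b :=
  ⟨fun ⟨p, h⟩ => ⟨_, h.tail (symm (Move.right_to ε p ha hab).step)⟩,
    fun ⟨p, h⟩ => ⟨_, h.tail (Move.right ε a b p ha hab).step⟩⟩

theorem occurs_turn_iff (ha : a ≤ n) (hb : b ≤ n) (hab : n < a + b) :
    Occurs n K (!ε) (2 * n + 1 - (a + b)) a ↔ Occurs n K ε a b :=
  ⟨fun ⟨p, h⟩ => ⟨_, h.tail (symm (Move.turn_to ε p ha hb hab).step)⟩,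
    fun ⟨p, h⟩ => ⟨_, h.tail (Move.turn ε a b p ha hb hab).step⟩⟩

theorem occurs_iff_of_coprime (ha : 1 ≤ a) (han : a ≤ n) (hbn : b ≤ n) (hab : a.Coprime b) :
    Occurs n K ε a b ↔ Occurs n K ε 1 0 := by
  induction h : a + b using Nat.strong_induction_on generalizing a b with
  | _ m ih =>
    subst h
    rcases Nat.eq_zero_or_pos b with rfl | hb
    · rw [(Nat.coprime_zero_right a).1 hab]
    rcases le_or_gt a b with hle | hlt
    · obtain ⟨c, rfl⟩ := Nat.exists_eq_add_of_le hle
      rw [occurs_up_iff ha hbn]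
      exact ih (a + c) (by omega) ha han (by omega) (by simpa using hab) rfl
    · obtain ⟨c, rfl⟩ := Nat.exists_eq_add_of_le' hlt.le
      rw [occurs_right_iff (by omega) han]
      exact ih (c + b) (by omega) (by omega) (by omega) hbn (by simpa using hab) rfl

theorem occurs_one_zero (hn : 1 ≤ n) (K : ℝ) (ε : Bool) : Occurs n K ε 1 0 := by
  have occurs_one_n : Occurs n K true 1 n := ⟨0, .refl⟩
  cases ε
  · rwa [← occurs_turn_iff hn le_rfl (by omega),
      occurs_iff_of_coprime (by omega) (by omega) hn (Nat.coprime_one_right _)] at occurs_one_n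
  · rwa [occurs_iff_of_coprime le_rfl hn le_rfl (Nat.coprime_one_left n)] at occurs_one_n

theorem occurs_mul_iff (hk : 1 ≤ k) (l : ℕ) (hkl : k * l ≤ n) :
    Occurs n K ε k (k * l) ↔ Occurs n K ε k 0 := by
  induction l with
  | zero => rw [mul_zero]
  | succ l ih =>
    rw [Nat.mul_succ, add_comm] at hkl ⊢
    rw [occurs_up_iff hk hkl, ih (by omega)]

theorem occurs_zero_of_coprime (hk : 1 ≤ k) (hkn : k ≤ n) (hc : (2 * n + 1).Coprime k)
    (K : ℝ) (ε : Bool) : Occurs n K ε k 0 := by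
  have mul_div_le : k * (n / k) ≤ n := Nat.mul_div_le n k
  have lt_add_mul_div : n < k + k * (n / k) := by
    rw [add_comm, ← Nat.mul_succ]
    exact Nat.lt_mul_div_succ n hk
  have coprime : (2 * n + 1 - (k + k * (n / k))).Coprime k := by
    have add_mul_div_eq : k + k * (n / k) = (1 + n / k) * k := by ring
    rw [add_mul_div_eq, Nat.coprime_iff_gcd_eq_one, Nat.gcd_sub_mul_right_left]
    · exact hc
    · omega
  rw [← occurs_mul_iff hk _ mul_div_le, ← occurs_turn_iff hkn mul_div_le lt_add_mul_div,
    occurs_iff_of_coprime (by omega) (by omega) hkn coprime]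
  exact occurs_one_zero (by omega) K _

end Occurs

theorem mul_cosecSq_mem_periods {n : ℕ} (hn : 1 ≤ n) (K : ℝ) (x : (ZMod (2 * n + 1))ˣ) :
    K * cosecSq n x ∈ periods n K := by
  let k := (x : ZMod (2 * n + 1)).valMinAbs.natAbs
  have one_le_k : 1 ≤ k := one_le_natAbs_valMinAbs hn x
  have k_le : k ≤ n := natAbs_valMinAbs_le _
  obtain ⟨p, hp⟩ := occurs_zero_of_coprime one_le_k k_le (coprime_natAbs_valMinAbs x) K true
  have neg_mem : -(K * increment n k 0) ∈ periods n K :=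
    hp.mem_periods (hp.tail (Move.right true k 0 p one_le_k k_le).step)
  have increment_eq : increment n k 0 = cosecSq n x := by
    rw [← cosecSq_natAbs_valMinAbs, cosecSq_natCast, increment, BeltFrame.displacement,
      Nat.cast_zero, zero_mul, cos_zero, add_zero, sq]
  rw [← increment_eq]
  exact neg_mem_iff.1 neg_mem

theorem totient_le_two_mul_finrank_periods {n : ℕ} (hn : 1 ≤ n) {K : ℝ} (hK : K ≠ 0) :
    Nat.totient (2 * n + 1) ≤ 2 * Module.finrank ℤ (periods n K) := by
  have := finite_periods n K
  have linearIndependent := (linearIndependent_cosecSq hn).map' (LinearMap.mulLeft ℚ K)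
    (LinearMap.ker_eq_bot.2 (mul_right_injective₀ hK))
  rw [← two_mul_card_unitsModSign hn]
  exact Nat.mul_le_mul_left 2 <|
    card_le_finrank_int linearIndependent fun g => mul_cosecSq_mem_periods hn K g.out

theorem finrank_periods {n : ℕ} (hn : 1 ≤ n) {K : ℝ} (hK : K ≠ 0) :
    Module.finrank ℤ (periods n K) = Nat.totient (2 * n + 1) / 2 := by
  have upper := two_mul_finrank_periods_le hn hK
  have lower := totient_le_two_mul_finrank_periods hn hK
  omega

namespace BeltFrame

variable (F : BeltFrame T) {n : ℕ} (hn : 1 ≤ n)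
  (h₀ : initialSeed n T = F.seedOf n (initialParam n))

theorem norm_e : ‖F.e‖ = 1 := by
  rw [norm_eq_sqrt_real_inner, F.inner_e_e, Real.sqrt_one]

section
include hn h₀

theorem exists_isReachable_eq_seedOf (x : ExchangeVertex n T) :
    ∃ s, s.Valid n ∧ IsReachable n F.K s ∧ x.1 = F.seedOf n s := by
  obtain ⟨x, hx⟩ := x
  rw [h₀] at hx
  exact (F.reflTransGen_isMutation_iff (initialParam_valid hn) _).1 hx

theorem reflTransGen_isMutation_seedOf {s : SeedParam} (hs : IsReachable n F.K s) :
    Relation.ReflTransGen (IsMutation T) (initialSeed n T) (F.seedOf n s) := by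
  rw [h₀]
  exact (F.reflTransGen_isMutation_iff (initialParam_valid hn) _).2 ⟨s, hs.valid hn, hs, rfl⟩

theorem translationLattice_eq : translationLattice n T = periods n F.K := by
  refine le_antisymm ((AddSubgroup.closure_le _).2 ?_) fun u hu => ?_
  · rintro _ ⟨w, x, y, hxy, rfl⟩
    obtain ⟨s, hs, s_reachable, hx⟩ := F.exists_isReachable_eq_seedOf hn h₀ x
    obtain ⟨t, ht, t_reachable, hy⟩ := F.exists_isReachable_eq_seedOf hn h₀ y
    rw [hx, hy] at hxy
    obtain ⟨s_eq_shift, rfl⟩ := F.seedOf_eq_translate hs ht hxy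
    have sub_mem : s.p - t.p ∈ periods n F.K := t_reachable.mem_periods (s_eq_shift ▸ s_reachable)
    rw [norm_smul, F.norm_e, mul_one, Real.norm_eq_abs]
    exact abs_mem_iff.2 sub_mem
  · have abs_mem : |u| ∈ translationLattice n T := by
      refine AddSubgroup.subset_closure ⟨u • F.e, ⟨F.seedOf n ((initialParam n).shift u),
        F.reflTransGen_isMutation_seedOf hn h₀ hu⟩, initialVertex n T, ?_, ?_⟩
      · exact (F.translate_seedOf n u _).symm.trans (congrArg (translate (u • F.e)) h₀.symm)
      · rw [norm_smul, F.norm_e, mul_one, Real.norm_eq_abs]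
    exact abs_mem_iff.1 abs_mem

theorem exchangeGraph_adj_iff {x y : ExchangeVertex n T} :
    (exchangeGraph n T).Adj x y ↔ x ≠ y ∧ IsMutation T x.1 y.1 := by
  have isMutation_symm : IsMutation T y.1 x.1 → IsMutation T x.1 y.1 := fun h => by
    obtain ⟨s, hs, -, hy⟩ := F.exists_isReachable_eq_seedOf hn h₀ y
    rw [hy] at h ⊢
    obtain ⟨t, step, hx⟩ := (F.isMutation_seedOf_iff hs _).1 h
    rw [hx]
    exact (F.isMutation_seedOf_iff step.valid _).2 ⟨s, symm step, rfl⟩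
  rw [exchangeGraph, SimpleGraph.fromRel_adj, or_iff_left_of_imp isMutation_symm]

theorem finite_exchangeGraph_adj (x : ExchangeVertex n T) :
    {y | (exchangeGraph n T).Adj x y}.Finite := by
  obtain ⟨s, hs⟩ := Quotient.exists_rep x.1
  refine ((Set.finite_range fun k => (Quotient.mk _ (s.mutate T k) : Seed)).preimage
    Subtype.val_injective.injOn).subset fun y hy => ?_
  have isMutation := ((F.exchangeGraph_adj_iff hn h₀).1 hy).2
  rw [← hs] at isMutation
  obtain ⟨k, hk⟩ := (isMutation_mk_iff _ _).1 isMutation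
  exact ⟨k, hk.symm⟩

end

/-- The translation of the vertices of the exchange graph by a period. -/
def translateVertex (u : periods n F.K) (x : ExchangeVertex n T) : ExchangeVertex n T :=
  ⟨translate ((u : ℝ) • F.e) x.1, by
    obtain ⟨s, -, hs, hx⟩ := F.exists_isReachable_eq_seedOf hn h₀ x
    rw [hx, translate_seedOf]
    exact F.reflTransGen_isMutation_seedOf hn h₀ (hs.shift u.2)⟩

theorem translateVertex_val {x : ExchangeVertex n T} {s : SeedParam} (hx : x.1 = F.seedOf n s)
    (u : periods n F.K) : (F.translateVertex hn h₀ u x).1 = F.seedOf n (s.shift u) :=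
  (congrArg (translate _) hx).trans (F.translate_seedOf n u s)

theorem translateVertex_zero (x : ExchangeVertex n T) : F.translateVertex hn h₀ 0 x = x := by
  obtain ⟨s, -, -, hx⟩ := F.exists_isReachable_eq_seedOf hn h₀ x
  refine Subtype.ext ?_
  rw [F.translateVertex_val hn h₀ hx, hx, AddSubgroup.coe_zero, SeedParam.shift_zero]

theorem translateVertex_add (u v : periods n F.K) (x : ExchangeVertex n T) :
    F.translateVertex hn h₀ (u + v) x =
      F.translateVertex hn h₀ u (F.translateVertex hn h₀ v x) := by
  obtain ⟨s, -, -, hx⟩ := F.exists_isReachable_eq_seedOf hn h₀ x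
  refine Subtype.ext ?_
  have hvx := F.translateVertex_val hn h₀ hx v
  rw [F.translateVertex_val hn h₀ hx, F.translateVertex_val hn h₀ hvx, SeedParam.shift_shift,
    AddSubgroup.coe_add]

/-- The translation by a period as a permutation of the vertices of the exchange graph. -/
def translateEquiv (u : periods n F.K) : ExchangeVertex n T ≃ ExchangeVertex n T where
  toFun := F.translateVertex hn h₀ u
  invFun := F.translateVertex hn h₀ (-u)
  left_inv x := by rw [← translateVertex_add, neg_add_cancel, translateVertex_zero]
  right_inv x := by rw [← translateVertex_add, add_neg_cancel, translateVertex_zero]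

theorem isMutation_translateVertex (u : periods n F.K) {x y : ExchangeVertex n T}
    (h : IsMutation T x.1 y.1) :
    IsMutation T (F.translateVertex hn h₀ u x).1 (F.translateVertex hn h₀ u y).1 := by
  obtain ⟨s, hs, -, hx⟩ := F.exists_isReachable_eq_seedOf hn h₀ x
  rw [hx] at h
  obtain ⟨t, step, hy⟩ := (F.isMutation_seedOf_iff hs _).1 h
  rw [F.translateVertex_val hn h₀ hx, F.translateVertex_val hn h₀ hy]
  exact (F.isMutation_seedOf_iff (s := s.shift u) hs _).2 ⟨_, step.shift u, rfl⟩

theorem isMutation_translateVertex_iff (u : periods n F.K) {x y : ExchangeVertex n T} :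
    IsMutation T (F.translateVertex hn h₀ u x).1 (F.translateVertex hn h₀ u y).1 ↔
      IsMutation T x.1 y.1 := by
  refine ⟨fun h => ?_, F.isMutation_translateVertex hn h₀ u⟩
  simpa only [← translateVertex_add, neg_add_cancel, translateVertex_zero] using
    F.isMutation_translateVertex hn h₀ (-u) h

/-- The translation by a period as an automorphism of the exchange graph. -/
def translateIso (u : periods n F.K) : exchangeGraph n T ≃g exchangeGraph n T where
  toEquiv := F.translateEquiv hn h₀ u
  map_rel_iff' {x y} := by
    rw [F.exchangeGraph_adj_iff hn h₀, F.exchangeGraph_adj_iff hn h₀]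
    exact and_congr (F.translateEquiv hn h₀ u).injective.ne_iff
      (F.isMutation_translateVertex_iff hn h₀ u)

/-- The action of the periods on the exchange graph by translations. -/
def translateHom :
    Multiplicative (periods n F.K) →* (exchangeGraph n T ≃g exchangeGraph n T) where
  toFun u := F.translateIso hn h₀ u.toAdd
  map_one' := RelIso.ext (F.translateVertex_zero hn h₀)
  map_mul' u v := RelIso.ext (F.translateVertex_add hn h₀ u.toAdd v.toAdd)

theorem translateVertex_injective (x : ExchangeVertex n T) :
    Function.Injective fun u => F.translateVertex hn h₀ u x := fun u v h => by
  obtain ⟨s, hs, -, hx⟩ := F.exists_isReachable_eq_seedOf hn h₀ x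
  have seed_eq : F.seedOf n (s.shift u) = translate ((v : ℝ) • F.e) (F.seedOf n s) := by
    rw [← F.translateVertex_val hn h₀ hx, ← hx]
    exact congrArg Subtype.val h
  have smul_eq := (F.seedOf_eq_translate (s := s.shift u) hs hs seed_eq).2
  have e_ne : F.e ≠ 0 := norm_ne_zero_iff.1 (F.norm_e ▸ one_ne_zero)
  exact Subtype.ext <| ((smul_left_injective ℝ e_ne smul_eq).trans (add_sub_cancel_left s.p u)).symm

theorem finite_setOf_dist_translateHom_le (x : ExchangeVertex n T) (m : ℕ) :
    {u | (exchangeGraph n T).dist x (F.translateHom hn h₀ (.ofAdd u) x) ≤ m}.Finite :=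
  (finite_setOf_dist_le (exchangeGraph_connected n T) (F.finite_exchangeGraph_adj hn h₀) x
    m).preimage (F.translateVertex_injective hn h₀ x).injOn

theorem exists_finite_orbit_representatives :
    ∃ R : Set (ExchangeVertex n T), R.Finite ∧
      ∀ x, ∃ y ∈ R, ∃ u, F.translateHom hn h₀ (.ofAdd u) y = x := by
  choose s hs s_reachable hx using F.exists_isReachable_eq_seedOf hn h₀
  let shape (x : ExchangeVertex n T) : Bool × Fin (n + 1) × Fin (n + 1) :=
    ((s x).ε, ⟨(s x).a, Nat.lt_succ_of_le (hs x).2.1⟩, ⟨(s x).b, Nat.lt_succ_of_le (hs x).2.2⟩)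
  refine ⟨Set.range (Set.rangeSplitting shape), Set.finite_range _, fun x => ?_⟩
  let y := Set.rangeSplitting shape ⟨shape x, x, rfl⟩
  have shape_eq : shape y = shape x := Set.apply_rangeSplitting shape _
  have shift_eq : (s y).shift ((s x).p - (s y).p) = s x := by
    simp only [shape, Prod.mk.injEq, Fin.mk.injEq] at shape_eq
    exact SeedParam.ext shape_eq.1 shape_eq.2.1 shape_eq.2.2 (add_sub_cancel _ _)
  have mem_periods := (s_reachable y).mem_periods (shift_eq ▸ s_reachable x)
  refine ⟨y, ⟨_, rfl⟩, ⟨_, mem_periods⟩, Subtype.ext ?_⟩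
  exact (F.translateVertex_val hn h₀ (hx y) _).trans
    ((congrArg (F.seedOf n) shift_eq).trans (hx x).symm)

end BeltFrame

end

end AffineExchange

theorem corollary5p5 (n : ℕ) (hn : 1 ≤ n)
    (T : Affine.Triangle ℝ AffineExchange.Plane) (hT : AffineExchange.IsInitialTriangle n T) :
    -- translations by elements of `L` form an action of `L` on `Γ` by graph automorphisms
    ∃ τ : Multiplicative (AffineExchange.translationLattice n T) →*
        (AffineExchange.exchangeGraph n T ≃g AffineExchange.exchangeGraph n T),
      (∀ (w : AffineExchange.translationLattice n T) (x : AffineExchange.ExchangeVertex n T),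
        (τ (Multiplicative.ofAdd w) x).1 =
          AffineExchange.translate ((w : ℝ) • AffineExchange.beltDirection T) x.1) ∧
      -- the action is isometric
      (∀ (w : AffineExchange.translationLattice n T) (x y : AffineExchange.ExchangeVertex n T),
        AffineExchange.graphDist (AffineExchange.exchangeGraph n T)
            (τ (Multiplicative.ofAdd w) x) (τ (Multiplicative.ofAdd w) y) =
          AffineExchange.graphDist (AffineExchange.exchangeGraph n T) x y) ∧
      -- the action is properly discontinuous
      (∀ (x : AffineExchange.ExchangeVertex n T) (r : ℝ),
        {w : AffineExchange.translationLattice n T |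
          AffineExchange.graphDist (AffineExchange.exchangeGraph n T) x
            (τ (Multiplicative.ofAdd w) x) ≤ r}.Finite) ∧
      -- the quotient is finite
      (∃ F : Set (AffineExchange.ExchangeVertex n T), F.Finite ∧
        ∀ x, ∃ y ∈ F, ∃ w : AffineExchange.translationLattice n T,
          τ (Multiplicative.ofAdd w) y = x) ∧
      -- `L` is finitely generated, of rank `φ(2n+1)/2`
      Module.Finite ℤ (AffineExchange.translationLattice n T) ∧
      Module.finrank ℤ (AffineExchange.translationLattice n T) = Nat.totient (2 * n + 1) / 2 ∧
      -- the orbit map of the initial seed is a quasi-isometry from each Cayley graph of `L` to `Γ`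
      (∀ S : Set (AffineExchange.translationLattice n T),
        S.Finite → (∀ s ∈ S, -s ∈ S) → 0 ∉ S → AddSubgroup.closure S = ⊤ →
        AffineExchange.IsQuasiIsometry
          (AffineExchange.graphDist (SimpleGraph.addCayley S))
          (AffineExchange.graphDist (AffineExchange.exchangeGraph n T))
          (fun w => τ (Multiplicative.ofAdd w) (AffineExchange.initialVertex n T))) ∧
      -- `Γ` is quasi-isometric to `ℤ^r` for `r = φ(2n+1)/2`
      ∃ f : AffineExchange.ExchangeVertex n T → (Fin (Nat.totient (2 * n + 1) / 2) → ℤ),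
        AffineExchange.IsQuasiIsometry
          (AffineExchange.graphDist (AffineExchange.exchangeGraph n T))
          (AffineExchange.graphDist
            (AffineExchange.integerLatticeGraph (Nat.totient (2 * n + 1) / 2)))
          f := by
  open AffineExchange in
  obtain ⟨F, he, h₀⟩ := exists_beltFrame hn hT
  rw [F.translationLattice_eq hn h₀, ← he]
  have connected := exchangeGraph_connected n T
  have proper := F.finite_setOf_dist_translateHom_le hn h₀
  have cocompact := F.exists_finite_orbit_representatives hn h₀
  have finite := finite_periods n F.K
  have finrank := finrank_periods hn F.K_pos.ne'
  refine ⟨F.translateHom hn h₀, fun _ _ => rfl,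
    fun _ _ _ => congrArg Nat.cast (dist_iso_apply _ _ _),
    fun x r => (proper x ⌊r⌋₊).subset fun _ hw => Nat.le_floor hw,
    cocompact, finite, finrank, fun S hS _ _ hgen => ?_,
    exists_isQuasiIsometry_integerLatticeGraph _ _ connected proper cocompact finrank⟩
  exact (svarc_milnor _ (isTranslationInvariant_addCayley S) (addCayley_connected hgen)
    (finite_addCayley_adj_zero hS) connected proper cocompact _).1
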